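/- Fix $T,d\in\mathbb N$ and a standard Borel probability space $(\Omega,\mathcal F,\mathbb P)$ carrying independent standard Gaussian vectors $G_1,\dots,G_T$ in $\mathbb R^d$; put $\mathcal F_t=\sigma(G_1,\dots,G_t)$. Let $L^2_{\rm ad}$ be the set of square-integrable $(\mathcal F_t)_{t=1}^T$-adapted processes $Z=(Z_t)_{t=1}^T$ with values in $\mathbb R^d$. Write $Z\sim_{\rm ad}Z'$ if the nested conditional laws coincide, $$\mathrm{law}(\mathrm{law}(\cdots\mathrm{law}(Z\mid\mathcal F_{T-1})\cdots\mid\mathcal F_1))=\mathrm{law}(\mathrm{law}(\cdots\mathrm{law}(Z'\mid\mathcal F_{T-1})\cdots\mid\mathcal F_1)),$$ let $[Z]$ be the equivalence class of $Z$ and ${\rm FP}_2=L^2_{\rm ad}/_{\sim_{\rm ad}}$, and define $\mathcal{AW}_2$ on ${\rm FP}_2$ by $$\mathcal{AW}_2^2([X],[Y])=\inf_{X'\sim_{\rm ad}X,\;Y'\sim_{\rm ad}Y}\mathbb E\big[|X'-Y'|^2\big].$$ Let $\mathbf L$ be the set of real $dT\times dT$ block-lower triangular matrices with $d\times d$ blocks,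 and $\mathbf O\subset\mathbf L$ the set of block-diagonal matrices with orthogonal $d\times d$ diagonal blocks. For $L,M\in\mathbf L$ let $\mathbf O^\ast(L,M)$ be the set of minimizers of $O\mapsto\|L-MO\|_{\rm F}^2$ over $\mathbf O$. For $L\in\mathbf L$ and $a\in(\mathbb R^d)^T$, $a+LG$ is the process $(a_t+\sum_{s\le t}L_{t,s}G_s)_{t=1}^T$; let ${\rm GP}\subset{\rm FP}_2$ be the set of all classes $[a+LG]$. A constant-speed geodesic in ${\rm GP}$ is a map $\gamma:[0,1]\to{\rm GP}$ with $\mathcal{AW}_2(\gamma(u),\gamma(v))=|u-v|\,\mathcal{AW}_2(\gamma(0),\gamma(1))$ for all $u,v\in[0,1]$. **Theorem.** Let $L,M\in\mathbf L$, $X=[LG]$ and $Y=[MG]$. (i) If $P\in\mathbf O^\ast(L,M)$, then $(LG,MPG)$ are $\mathcal{AW}_2$-optimal representatives of $X,Y$: $[LG]=X$, $[MPG]=Y$ and $\mathcal{AW}_2^2(X,Y)=\mathbb E[|LG-MPG|^2]$. (ii) If $P\in\mathbf O^\ast(L,M)$, then $$\gamma(u):=[((1-u)L+uMP)G],\qquad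 u\in[0,1],\tag{$*$}$$ is a constant-speed geodesic in ${\rm GP}$ with $\gamma(0)=X$ and $\gamma(1)=Y$. (iii) If $(\gamma(u))_{u\in[0,1]}$ is a constant-speed geodesic in ${\rm GP}$ with $\gamma(0)=X$ and $\gamma(1)=Y$, then there is $P\in\mathbf O^\ast(L,M)$ such that $(*)$ holds for all $u\in[0,1]$. -/

import Mathlib

open MeasureTheory ProbabilityTheory

noncomputable section

namespace AdaptedBW

set_option linter.unusedSectionVars false

/-! ### Block matrices

A real `dT × dT` matrix is represented by its `T × T` array of `d × d` blocks: `A t s` is the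
block `A_{t,s}`. Addition, scaling and multiplication are those of Mathlib for matrices over the
ring of `d × d` matrices, hence agree with the usual operations on `dT × dT` matrices. -/

/-- Real `dT × dT` matrices in block notation. -/
abbrev BlockMatrix (T d : ℕ) : Type := Matrix (Fin T) (Fin T) (Matrix (Fin d) (Fin d) ℝ)

/-- The set `𝐋` of block-lower triangular matrices (as a subalgebra of all matrices). -/
def BlockLower (T d : ℕ) : Subalgebra ℝ (BlockMatrix T d) where
  carrier := {A | ∀ t s : Fin T, t < s → A t s = 0}
  mul_mem' := by
    intro A B hA hB t s hts
    rw [Matrix.mul_apply]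
    refine Finset.sum_eq_zero fun r _ => ?_
    rcases lt_or_ge t r with h | h
    · rw [hA t r h, zero_mul]
    · rw [hB r s (lt_of_le_of_lt h hts), mul_zero]
  add_mem' := by
    intro A B hA hB t s hts
    rw [Matrix.add_apply, hA t s hts, hB t s hts, add_zero]
  algebraMap_mem' := by
    intro r t s hts
    rw [Matrix.algebraMap_matrix_apply, if_neg hts.ne]

/-- The set `𝐎 ⊆ 𝐋` of block-diagonal matrices with orthogonal `d × d` diagonal blocks. -/
def BlockOrth (T d : ℕ) : Set (BlockLower T d) :=
  {O | ∃ Q : Fin T → Matrix (Fin d) (Fin d) ℝ,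
    (∀ t, Q t ∈ Matrix.orthogonalGroup (Fin d) ℝ) ∧ (O : BlockMatrix T d) = Matrix.diagonal Q}

/-- The squared Frobenius norm: the sum of the squares of all entries. -/
def frobSq {T d : ℕ} (A : BlockLower T d) : ℝ :=
  ∑ t, ∑ s, ∑ i, ∑ j, ((A : BlockMatrix T d) t s i j) ^ 2

/-- `𝐎*(L, M)`: the set of minimizers of `O ↦ ‖L - M O‖_F²` over `𝐎`. -/
def OptOrth {T d : ℕ} (L M : BlockLower T d) : Set (BlockLower T d) :=
  {P | P ∈ BlockOrth T d ∧ ∀ O ∈ BlockOrth T d, frobSq (L - M * P) ≤ frobSq (L - M * O)}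

/-! ### The stochastic basis and adapted processes -/

/-- The path space `(ℝ^d)^T`. -/
abbrev Path (T d : ℕ) : Type := Fin T → EuclideanSpace ℝ (Fin d)

/-- `T` independent `d`-dimensional standard Gaussian random vectors. -/
structure GaussianBasis {Ω : Type*} [MeasurableSpace Ω] (μ : Measure Ω) (T d : ℕ) where
  /-- The Gaussian vectors. -/
  G : Fin T → Ω → EuclideanSpace ℝ (Fin d)
  measurable : ∀ t, Measurable (G t)
  law : ∀ t, μ.map (G t) = stdGaussian (EuclideanSpace ℝ (Fin d))
  indep : iIndepFun G μ

/-- The regular conditional law `law(Z | m)`, as a random measure. -/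
def condLaw {Ω : Type*} (m : MeasurableSpace Ω) [mΩ : MeasurableSpace Ω] [StandardBorelSpace Ω]
    (μ : Measure Ω) [IsFiniteMeasure μ] {α : Type} [MeasurableSpace α] (Z : Ω → α) (ω : Ω) :
    Measure α :=
  (condExpKernel μ m ω).map Z

section Basis

variable {Ω : Type*} [MeasurableSpace Ω] [StandardBorelSpace Ω]
  {μ : Measure Ω} [IsProbabilityMeasure μ] {T d : ℕ}

/-- The σ-algebra generated by the first `n` Gaussian vectors. With times `1, …, T` of the
process encoded by `Fin T = {0, …, T - 1}`, the σ-algebra at the time encoded by `t` is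
`B.hist (t + 1)`. -/
@[reducible]
def GaussianBasis.hist (B : GaussianBasis μ T d) (n : ℕ) : MeasurableSpace Ω :=
  ⨆ s : Fin T, ⨆ _ : (s : ℕ) < n, MeasurableSpace.comap (B.G s) inferInstance

/-- The space `L²_ad((ℝ^d)^T)` of square-integrable adapted processes. -/
structure AdaptedL2 (B : GaussianBasis μ T d) where
  /-- The path of the process. -/
  path : Ω → Path T d
  adapted : ∀ t : Fin T, Measurable[B.hist ((t : ℕ) + 1)] fun ω => path ω t
  memLp : ∀ t : Fin T, MemLp (fun ω => path ω t) 2 μ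

/-- `SameNestedLaw B n Z Z'` says that, with `ℱ_k = B.hist k`,
`law(law(… law(Z | ℱ_n) … | ℱ_1)) = law(law(… law(Z' | ℱ_n) … | ℱ_1))`. -/
def SameNestedLaw (B : GaussianBasis μ T d) :
    ℕ → ∀ {α : Type} [MeasurableSpace α], (Ω → α) → (Ω → α) → Prop
  | 0, _, _, Z, Z' => μ.map Z = μ.map Z'
  | n + 1, _, _, Z, Z' =>
    SameNestedLaw B n (condLaw (B.hist (n + 1)) μ Z) (condLaw (B.hist (n + 1)) μ Z')

/-- `Z ∼_ad Z'`: the processes have the same adapted distribution, i.e. their nested conditional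
laws along `ℱ_{T-1}, …, ℱ_1` coincide. -/
def AdEquiv {B : GaussianBasis μ T d} (Z Z' : AdaptedL2 B) : Prop :=
  SameNestedLaw B (T - 1) Z.path Z'.path

theorem sameNestedLaw_refl (B : GaussianBasis μ T d) (n : ℕ) :
    ∀ {α : Type} [MeasurableSpace α] (Z : Ω → α), SameNestedLaw B n Z Z := by
  induction n with
  | zero => intro α _ Z; rfl
  | succ n ih => intro α _ Z; exact ih _

theorem sameNestedLaw_symm (B : GaussianBasis μ T d) (n : ℕ) :
    ∀ {α : Type} [MeasurableSpace α] {Z Z' : Ω → α},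
      SameNestedLaw B n Z Z' → SameNestedLaw B n Z' Z := by
  induction n with
  | zero => intro α _ Z Z' h; exact Eq.symm h
  | succ n ih => intro α _ Z Z' h; exact ih h

theorem sameNestedLaw_trans (B : GaussianBasis μ T d) (n : ℕ) :
    ∀ {α : Type} [MeasurableSpace α] {Z Z' Z'' : Ω → α},
      SameNestedLaw B n Z Z' → SameNestedLaw B n Z' Z'' → SameNestedLaw B n Z Z'' := by
  induction n with
  | zero => intro α _ Z Z' Z'' h h'; exact Eq.trans h h'
  | succ n ih => intro α _ Z Z' Z'' h h'; exact ih h h'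

instance adSetoid (B : GaussianBasis μ T d) : Setoid (AdaptedL2 B) where
  r := AdEquiv
  iseqv := ⟨fun Z => sameNestedLaw_refl B _ Z.path, fun h => sameNestedLaw_symm B _ h,
    fun h h' => sameNestedLaw_trans B _ h h'⟩

/-! ### The adapted Wasserstein distance -/

/-- The transport cost `𝔼[|X - Y|²]`, with the Euclidean norm on `(ℝ^d)^T`. -/
def cost {B : GaussianBasis μ T d} (X Y : AdaptedL2 B) : ℝ :=
  ∫ ω, ∑ t, ‖X.path ω t - Y.path ω t‖ ^ 2 ∂μ

/-- `𝒜𝒲₂²(X, Y)`: the infimum of `𝔼[|X' - Y'|²]` over `X' ∼_ad X` and `Y' ∼_ad Y`. -/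
def awSq {B : GaussianBasis μ T d} (X Y : AdaptedL2 B) : ℝ :=
  sInf {c | ∃ X' Y' : AdaptedL2 B, AdEquiv X' X ∧ AdEquiv Y' Y ∧ c = cost X' Y'}

theorem awSq_congr {B : GaussianBasis μ T d} (X₁ Y₁ X₂ Y₂ : AdaptedL2 B)
    (hX : X₁ ≈ X₂) (hY : Y₁ ≈ Y₂) : awSq X₁ Y₁ = awSq X₂ Y₂ := by
  unfold awSq
  congr 1
  ext c
  constructor
  · rintro ⟨X', Y', h, h', rfl⟩
    exact ⟨X', Y', sameNestedLaw_trans B _ h hX, sameNestedLaw_trans B _ h' hY, rfl⟩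
  · rintro ⟨X', Y', h, h', rfl⟩
    exact ⟨X', Y', sameNestedLaw_trans B _ h (sameNestedLaw_symm B _ hX),
      sameNestedLaw_trans B _ h' (sameNestedLaw_symm B _ hY), rfl⟩

/-- The Wasserstein space of stochastic processes `FP₂ = L²_ad((ℝ^d)^T) / ∼_ad`. -/
abbrev FP (B : GaussianBasis μ T d) : Type _ := Quotient (adSetoid B)

/-- The adapted Wasserstein distance `𝒜𝒲₂` on `FP₂`. -/
def AW {B : GaussianBasis μ T d} (x y : FP B) : ℝ :=
  √(Quotient.lift₂ awSq awSq_congr x y)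

/-- `X', Y'` are `𝒜𝒲₂`-optimal representatives of `x, y`. -/
def IsOptimalRep {B : GaussianBasis μ T d} (x y : FP B) (X' Y' : AdaptedL2 B) : Prop :=
  (⟦X'⟧ : FP B) = x ∧ (⟦Y'⟧ : FP B) = y ∧ AW x y ^ 2 = cost X' Y'

/-! ### Gaussian processes -/

theorem measurable_G_hist (B : GaussianBasis μ T d) {s : Fin T} {n : ℕ} (h : (s : ℕ) < n) :
    Measurable[B.hist n] (B.G s) := by
  rw [measurable_iff_comap_le]
  exact le_iSup₂ (f := fun (s : Fin T) (_ : (s : ℕ) < n) =>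
    MeasurableSpace.comap (B.G s) inferInstance) s h

theorem memLp_G (B : GaussianBasis μ T d) (s : Fin T) : MemLp (B.G s) 2 μ := by
  have h : MemLp id 2 (μ.map (B.G s)) := by
    rw [B.law s]
    exact IsGaussian.memLp_two_id
  exact (memLp_map_measure_iff h.1 (B.measurable s).aemeasurable).1 h

/-- The path of `X = a + L G`, that is, `X_t = a_t + ∑_{s ≤ t} L_{t,s} G_s` (the blocks `L_{t,s}`
with `s > t` are zero). -/
def gaussPath (B : GaussianBasis μ T d) (a : Path T d) (L : BlockLower T d) (ω : Ω) : Path T d :=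
  fun t => a t + ∑ s, Matrix.toEuclideanCLM (𝕜 := ℝ) ((L : BlockMatrix T d) t s) (B.G s ω)

theorem measurable_gaussPath (B : GaussianBasis μ T d) (a : Path T d) (L : BlockLower T d)
    (t : Fin T) : Measurable[B.hist ((t : ℕ) + 1)] fun ω => gaussPath B a L ω t := by
  refine Measurable.const_add (Finset.measurable_fun_sum _ fun s _ => ?_) _
  rcases lt_or_ge t s with h | h
  · have h0 : (L : BlockMatrix T d) t s = 0 := L.2 t s h
    have h1 : (fun ω => Matrix.toEuclideanCLM (𝕜 := ℝ) ((L : BlockMatrix T d) t s) (B.G s ω))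
        = fun _ => 0 := by
      funext ω
      rw [h0, map_zero]
      rfl
    rw [h1]
    exact @measurable_const _ _ _ (B.hist (t + 1)) _
  · have hc : Measurable (Matrix.toEuclideanCLM (𝕜 := ℝ) ((L : BlockMatrix T d) t s)) :=
      (Matrix.toEuclideanCLM (𝕜 := ℝ) ((L : BlockMatrix T d) t s)).continuous.measurable
    exact hc.comp (measurable_G_hist B (Nat.lt_succ_of_le h))

theorem memLp_gaussPath (B : GaussianBasis μ T d) (a : Path T d) (L : BlockLower T d)
    (t : Fin T) : MemLp (fun ω => gaussPath B a L ω t) 2 μ := by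
  have h : ∀ s ∈ Finset.univ, MemLp (fun ω =>
      Matrix.toEuclideanCLM (𝕜 := ℝ) ((L : BlockMatrix T d) t s) (B.G s ω)) 2 μ := fun s _ =>
    (Matrix.toEuclideanCLM (𝕜 := ℝ) ((L : BlockMatrix T d) t s)).comp_memLp' (memLp_G B s)
  exact (memLp_const (a t)).add (memLp_finsetSum Finset.univ h)

/-- The Gaussian process `X = a + L G` as an element of `L²_ad`. -/
def gaussProc (B : GaussianBasis μ T d) (a : Path T d) (L : BlockLower T d) :
    AdaptedL2 B where
  path := gaussPath B a L
  adapted t := measurable_gaussPath B a L t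
  memLp t := memLp_gaussPath B a L t

/-- The class in `FP₂` of the centered Gaussian process `L G`. -/
def gaussianClass (B : GaussianBasis μ T d) (L : BlockLower T d) : FP B :=
  ⟦gaussProc B 0 L⟧

/-- `GP ⊆ FP₂`: the classes of all Gaussian processes `a + L G`. -/
def GP (B : GaussianBasis μ T d) : Set (FP B) :=
  {x | ∃ (a : Path T d) (L : BlockLower T d), x = ⟦gaussProc B a L⟧}

/-- `γ : [0,1] → GP` is a constant-speed geodesic in `(GP, 𝒜𝒲₂)`. -/
def IsGeodesicGP {B : GaussianBasis μ T d} (γ : unitInterval → FP B) : Prop :=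
  (∀ u, γ u ∈ GP B) ∧
    ∀ u v : unitInterval, AW (γ u) (γ v) = |(u : ℝ) - (v : ℝ)| * AW (γ 0) (γ 1)

/-- The curve `u ↦ [((1 - u) L + u M P) G]`. -/
def interpolation (B : GaussianBasis μ T d) (L M P : BlockLower T d) (u : unitInterval) : FP B :=
  gaussianClass B ((1 - (u : ℝ)) • L + (u : ℝ) • (M * P))

end Basis

end AdaptedBW

end

noncomputable section

set_option linter.unusedSectionVars false

namespace AdaptedBW

open scoped InnerProductSpace

/-! On Gaussian classes the adapted distance is a Euclidean quotient distance. For centered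
processes it is `orbitDist L M`, the least Frobenius distance `‖L - M O‖` over the compact group
`BlockOrth`, which acts isometrically by right multiplication; a difference of means adds its
squared norm.

Lower bound: the nested law determines the second moments of all conditional expectations
(`SameNestedLaw.integral_condExp_mul_eq`), hence the Gram matrix of the martingale increments of the
entries at each time `k`. For `a + L G` this is the Gram matrix of the rows of block column `k` of
`L`. Increments at different times are orthogonal, so the cost of a coupling splits over `k`.
Gelbrich's bound `exists_isometry_sum_inner_le` supplies, for each `k`, one rotation doing at least
as well (`exists_le_cost`).

Upper bound: rotating each Gaussian vector gives a Gaussian basis with the same filtration, so `M P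
G` and `M G` have the same nested law (`adEquiv_gaussProc_mul`).

What remains is geometry of a quotient by a compact group of isometries. An optimally aligned
segment projects to a geodesic by the triangle inequality. Conversely, finitely many points of a
geodesic can be aligned successively without losing length, so they lie on a segment by strict
convexity; compactness of `OptOrth L M` then yields one `P` for all times (`exists_segment_lift`).
Intermediate means vanish because a mean only adds to the distance. -/

/-! ### Linear algebra: Gram matrices, singular values and Gelbrich's bound -/

/-- Two families of vectors with the same Gram matrix are related by a contraction. -/
theorem exists_contraction_of_gram_eq {ι E H : Type*} [Fintype ι]
    [NormedAddCommGroup E] [InnerProductSpace ℝ E] [FiniteDimensional ℝ E]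
    [NormedAddCommGroup H] [InnerProductSpace ℝ H] (a : ι → E) (u : ι → H)
    (h : ∀ i j, ⟪u i, u j⟫_ℝ = ⟪a i, a j⟫_ℝ) :
    ∃ S : E →ₗ[ℝ] H, (∀ i, S (a i) = u i) ∧ ∀ x, ‖S x‖ ≤ ‖x‖ := by
  classical
  let φ : (ι → ℝ) →ₗ[ℝ] H := Fintype.linearCombination ℝ u
  let ψ : (ι → ℝ) →ₗ[ℝ] E := Fintype.linearCombination ℝ a
  have hφ : ∀ c, φ c = ∑ i, c i • u i := fun c => rfl
  have hψ : ∀ c, ψ c = ∑ i, c i • a i := fun c => rfl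
  have hn : ∀ c, ‖φ c‖ = ‖ψ c‖ := by
    intro c
    rw [← sq_eq_sq₀ (norm_nonneg _) (norm_nonneg _), ← real_inner_self_eq_norm_sq,
      ← real_inner_self_eq_norm_sq, hφ, hψ]
    simp only [sum_inner, inner_sum, real_inner_smul_left, real_inner_smul_right, h]
  -- A linear choice of coefficients on the span of the `a i`. By `hn` the resulting map is
  -- isometric there, whichever choice is made; composing with the orthogonal projection makes it a
  -- contraction on all of `E`.
  obtain ⟨g, hg⟩ := ψ.rangeRestrict.exists_rightInverse_of_surjective ψ.range_rangeRestrict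
  have hg' : ∀ y, ψ (g y) = y := fun y => congrArg Subtype.val (LinearMap.congr_fun hg y)
  let R := LinearMap.range ψ
  refine ⟨φ ∘ₗ g ∘ₗ R.orthogonalProjectionOnto.toLinearMap, fun i => ?_, fun x => ?_⟩
  · have hai : ψ (Pi.single i 1) = a i := by simp [ψ]
    have hui : φ (Pi.single i 1) = u i := by simp [φ]
    have hmem : a i ∈ R := ⟨_, hai⟩
    have hp : R.orthogonalProjectionOnto (a i) = ⟨a i, hmem⟩ :=
      Submodule.orthogonalProjectionOnto_mem_subspace_eq_self (K := R) ⟨a i, hmem⟩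
    -- The two coefficient vectors have the same image under `ψ`, so `φ` annihilates their
    -- difference by `hn`.
    have h0 : ‖φ (g ⟨a i, hmem⟩ - Pi.single i 1)‖ = 0 := by
      rw [hn, map_sub, hg', hai, sub_self, norm_zero]
    rw [norm_eq_zero, map_sub, hui, sub_eq_zero] at h0
    simpa [hp] using h0
  · calc ‖φ (g (R.orthogonalProjectionOnto x))‖ = ‖R.orthogonalProjectionOnto x‖ := by
          rw [hn, hg']; rfl
      _ ≤ ‖x‖ := R.norm_orthogonalProjectionOnto_apply_le x

/-- Singular value decomposition of an endomorphism of a finite-dimensional space. -/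
theorem exists_singularValueDecomposition {E : Type*}
    [NormedAddCommGroup E] [InnerProductSpace ℝ E] [FiniteDimensional ℝ E] (N : E →ₗ[ℝ] E) :
    ∃ (e f : OrthonormalBasis (Fin (Module.finrank ℝ E)) ℝ E)
      (σ : Fin (Module.finrank ℝ E) → ℝ), (∀ i, 0 ≤ σ i) ∧ ∀ i, N (e i) = σ i • f i := by
  have hs : (LinearMap.adjoint N ∘ₗ N).IsSymmetric :=
    N.isSymmetric_adjoint_mul_self
  let e := hs.eigenvectorBasis rfl
  have hin : ∀ i j, ⟪N (e i), N (e j)⟫_ℝ = hs.eigenvalues rfl j * ⟪e i, e j⟫_ℝ := by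
    intro i j
    have := hs.apply_eigenvectorBasis rfl j
    rw [← LinearMap.adjoint_inner_right]
    have h2 : LinearMap.adjoint N (N (e j)) = hs.eigenvalues rfl j • e j := this
    rw [h2, real_inner_smul_right]
  -- The images of the eigenvectors of `N* N` are mutually orthogonal. The nonzero ones are
  -- normalized and completed to a basis; the vectors added belong to singular value zero.
  let s : Set (Fin (Module.finrank ℝ E)) := {i | N (e i) ≠ 0}
  let v : Fin (Module.finrank ℝ E) → E := fun i => ‖N (e i)‖⁻¹ • N (e i)
  have hv : Orthonormal ℝ (s.domRestrict v) := by
    constructor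
    · rintro ⟨i, hi⟩
      change ‖‖N (e i)‖⁻¹ • N (e i)‖ = 1
      rw [norm_smul, norm_inv, norm_norm]
      exact inv_mul_cancel₀ (norm_ne_zero_iff.2 hi)
    · rintro ⟨i, hi⟩ ⟨j, hj⟩ hij
      have hij' : i ≠ j := fun h => hij (Subtype.ext h)
      change ⟪‖N (e i)‖⁻¹ • N (e i), ‖N (e j)‖⁻¹ • N (e j)⟫_ℝ = 0
      rw [real_inner_smul_left, real_inner_smul_right, hin, e.inner_eq_zero hij']
      simp only [mul_zero]
  obtain ⟨f, hf⟩ := hv.exists_orthonormalBasis_extension_of_card_eq (by simp)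
  refine ⟨e, f, fun i => ‖N (e i)‖, fun i => norm_nonneg _, fun i => ?_⟩
  by_cases hi : N (e i) = 0
  · simp [hi]
  · rw [hf i hi, smul_smul, mul_inv_cancel₀ (norm_ne_zero_iff.2 hi), one_smul]

/-- Gelbrich's bound: the maximal cross-correlation of two families with prescribed Gram matrices
is attained by rotating the vectors representing these Gram matrices. -/
theorem exists_isometry_sum_inner_le {ι E H : Type*} [Fintype ι]
    [NormedAddCommGroup E] [InnerProductSpace ℝ E] [FiniteDimensional ℝ E]
    [NormedAddCommGroup H] [InnerProductSpace ℝ H] (a b : ι → E) (u v : ι → H)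
    (hu : ∀ i j, ⟪u i, u j⟫_ℝ = ⟪a i, a j⟫_ℝ) (hv : ∀ i j, ⟪v i, v j⟫_ℝ = ⟪b i, b j⟫_ℝ) :
    ∃ O : E ≃ₗᵢ[ℝ] E, ∑ i, ⟪u i, v i⟫_ℝ ≤ ∑ i, ⟪a i, O (b i)⟫_ℝ := by
  obtain ⟨S, hSa, hS⟩ := exists_contraction_of_gram_eq a u hu
  obtain ⟨R, hRb, hR⟩ := exists_contraction_of_gram_eq b v hv
  -- Both correlations are traces involving this cross operator. Writing `N e_j = σ_j f_j`,
  -- contractions give at most `∑ σ_j`, and the isometry sending `f_j` to `e_j` gives exactly `∑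
  -- σ_j`.
  let N : E →ₗ[ℝ] E := ∑ i, (innerₛₗ ℝ (a i)).smulRight (b i)
  have hN : ∀ x, N x = ∑ i, ⟪a i, x⟫_ℝ • b i := fun x => by simp [N]
  obtain ⟨e, f, σ, hσ, hNe⟩ := exists_singularValueDecomposition N
  have hexp : ∀ i, a i = ∑ j, ⟪a i, e j⟫_ℝ • e j := fun i => by
    conv_lhs => rw [← e.sum_repr' (a i)]
    exact Finset.sum_congr rfl fun j _ => by rw [real_inner_comm]
  refine ⟨f.equiv e (Equiv.refl _), ?_⟩
  set O := f.equiv e (Equiv.refl _)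
  have hO : ∀ j, O (f j) = e j := fun j => by simp [O]
  calc ∑ i, ⟪u i, v i⟫_ℝ = ∑ i, ⟪S (a i), R (b i)⟫_ℝ := by simp only [hSa, hRb]
    _ = ∑ i, ∑ j, ⟪a i, e j⟫_ℝ * ⟪S (e j), R (b i)⟫_ℝ := by
        refine Finset.sum_congr rfl fun i _ => ?_
        conv_lhs => rw [hexp i]
        simp only [map_sum, map_smul, sum_inner, real_inner_smul_left]
    _ = ∑ j, ⟪S (e j), R (N (e j))⟫_ℝ := by
        rw [Finset.sum_comm]
        simp only [hN, map_sum, map_smul, inner_sum, real_inner_smul_right]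
    _ ≤ ∑ j, σ j := by
        refine Finset.sum_le_sum fun j _ => ?_
        rw [hNe, map_smul, real_inner_smul_right]
        refine mul_le_of_le_one_right (hσ j) ((real_inner_le_norm _ _).trans ?_)
        have h1 := hS (e j)
        have h2 := hR (f j)
        rw [e.norm_eq_one] at h1
        rw [f.norm_eq_one] at h2
        exact mul_le_one₀ h1 (norm_nonneg _) h2
    _ = ∑ j, ⟪e j, O (N (e j))⟫_ℝ := by
        refine Finset.sum_congr rfl fun j _ => ?_
        rw [hNe, map_smul, real_inner_smul_right, hO, real_inner_self_eq_norm_sq, e.norm_eq_one]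
        ring
    _ = ∑ i, ∑ j, ⟪a i, e j⟫_ℝ * ⟪e j, O (b i)⟫_ℝ := by
        rw [Finset.sum_comm]
        simp only [hN, map_sum, map_smul, inner_sum, real_inner_smul_right]
    _ = ∑ i, ⟪a i, O (b i)⟫_ℝ := by
        refine Finset.sum_congr rfl fun i _ => ?_
        conv_rhs => rw [hexp i]
        simp only [sum_inner, real_inner_smul_left]

/-! ### Moments determined by the nested law -/

section NestedLaw

variable {Ω : Type*} {m : MeasurableSpace Ω} [mΩ : MeasurableSpace Ω] {μ : Measure Ω} {T d : ℕ}

theorem GaussianBasis.hist_le (B : GaussianBasis μ T d) (n : ℕ) : B.hist n ≤ mΩ :=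
  iSup₂_le fun s _ => (B.measurable s).comap_le

theorem GaussianBasis.hist_mono (B : GaussianBasis μ T d) {k n : ℕ} (h : k ≤ n) :
    B.hist k ≤ B.hist n :=
  iSup₂_le fun s hs => le_iSup₂ (f := fun (s : Fin T) (_ : (s : ℕ) < n) =>
    MeasurableSpace.comap (B.G s) inferInstance) s (hs.trans_le h)

theorem GaussianBasis.hist_zero (B : GaussianBasis μ T d) : B.hist 0 = ⊥ := by
  simp [GaussianBasis.hist]

variable [StandardBorelSpace Ω] [IsProbabilityMeasure μ]

theorem measurable_condLaw (hm : m ≤ mΩ) {α : Type} [MeasurableSpace α]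
    {Z : Ω → α} (hZ : Measurable Z) : Measurable (condLaw m μ Z) :=
  (Measure.measurable_map Z hZ).comp (((condExpKernel μ m).measurable).mono hm le_rfl)

theorem lintegral_condExpKernel (hm : m ≤ mΩ) {s : Set Ω}
    (hs : MeasurableSet s) : ∫⁻ ω, condExpKernel μ m ω s ∂μ = μ s := by
  conv_rhs => rw [← condExpKernel_comp_trim (μ := μ) hm]
  rw [Measure.bind_apply hs (Kernel.aemeasurable _), lintegral_trim hm]
  exact measurable_condExpKernel hs

theorem condLaw_congr_ae (hm : m ≤ mΩ) {α : Type} [MeasurableSpace α]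
    {Z Z' : Ω → α} (h : Z =ᵐ[μ] Z') : condLaw m μ Z =ᵐ[μ] condLaw m μ Z' := by
  have h1 : ∀ᵐ ω ∂μ, ∀ᵐ ω' ∂(condExpKernel μ m ω), Z ω' = Z' ω' := by
    refine ae_of_ae_trim hm (Measure.ae_ae_of_ae_comp ?_)
    rw [condExpKernel_comp_trim hm]
    exact h
  filter_upwards [h1] with ω hω using Measure.map_congr hω

/-- Processes with the same nested law have the same law. -/
theorem SameNestedLaw.map_eq {B : GaussianBasis μ T d} (n : ℕ) :
    ∀ {α : Type} [MeasurableSpace α] {Z Z' : Ω → α}, Measurable Z → Measurable Z' →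
      SameNestedLaw B n Z Z' → μ.map Z = μ.map Z' := by
  induction n with
  | zero => intro α _ Z Z' _ _ h; exact h
  | succ n ih =>
    intro α _ Z Z' hZ hZ' h
    have hW := measurable_condLaw (μ := μ) (B.hist_le (n + 1)) hZ
    have hW' := measurable_condLaw (μ := μ) (B.hist_le (n + 1)) hZ'
    -- The law of `Y` is the average of its conditional laws, hence a function of the law of
    -- `condLaw`.
    have key : ∀ {Y : Ω → α}, Measurable Y → ∀ {s : Set α}, MeasurableSet s →
        μ.map Y s = ∫⁻ ν, ν s ∂(μ.map (condLaw (B.hist (n + 1)) μ Y)) := by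
      intro Y hY s hs
      rw [lintegral_map (Measure.measurable_coe hs) (measurable_condLaw (B.hist_le _) hY),
        Measure.map_apply hY hs, ← lintegral_condExpKernel (B.hist_le (n + 1)) (hY hs)]
      exact lintegral_congr fun ω => (Measure.map_apply hY hs).symm
    ext s hs
    rw [key hZ hs, key hZ' hs, ih hW hW' h]

/-- The integral of `f` as an everywhere measurable function of the measure. -/
def integralFun {α : Type} [MeasurableSpace α] (f : α → ℝ) (ν : Measure α) : ℝ :=
  (∫⁻ x, ENNReal.ofReal (f x) ∂ν).toReal - (∫⁻ x, ENNReal.ofReal (-f x) ∂ν).toReal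

theorem measurable_integralFun {α : Type} [MeasurableSpace α] {f : α → ℝ} (hf : Measurable f) :
    Measurable (integralFun f) :=
  (Measure.measurable_lintegral hf.ennreal_ofReal).ennreal_toReal.sub
    (Measure.measurable_lintegral hf.neg.ennreal_ofReal).ennreal_toReal

/-- A conditional expectation is a fixed measurable functional of the conditional law. This lets
moment identities descend one level of nesting at a time. -/
theorem integralFun_condLaw_ae_eq (hm : m ≤ mΩ) {α : Type}
    [MeasurableSpace α] {Z : Ω → α} (hZ : Measurable Z) {f : α → ℝ} (hf : Measurable f)
    (hint : Integrable (f ∘ Z) μ) :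
    integralFun f ∘ condLaw m μ Z =ᵐ[μ] μ[f ∘ Z | m] := by
  filter_upwards [condExp_ae_eq_integral_condExpKernel hm hint, hint.condExpKernel_ae (m := m)]
    with ω h1 h2
  rw [h1, integral_eq_lintegral_pos_part_sub_lintegral_neg_part h2]
  simp only [integralFun, condLaw, Function.comp_apply]
  rw [lintegral_map hf.ennreal_ofReal hZ,
    lintegral_map (f := fun x => ENNReal.ofReal (-f x)) hf.neg.ennreal_ofReal hZ]

theorem integral_comp_eq_of_map_eq {α : Type} [MeasurableSpace α] {Z Z' : Ω → α}
    (hZ : Measurable Z) (hZ' : Measurable Z') (h : μ.map Z = μ.map Z') {f : α → ℝ}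
    (hf : Measurable f) : ∫ ω, f (Z ω) ∂μ = ∫ ω, f (Z' ω) ∂μ := by
  rw [← integral_map hZ.aemeasurable hf.aestronglyMeasurable, h,
    integral_map hZ'.aemeasurable hf.aestronglyMeasurable]

/-- The second moments of conditional expectations are determined by the nested law. -/
theorem SameNestedLaw.integral_condExp_mul_eq {B : GaussianBasis μ T d} (n : ℕ) :
    ∀ {α : Type} [MeasurableSpace α] {Z Z' : Ω → α}, Measurable Z → Measurable Z' →
      SameNestedLaw B n Z Z' → ∀ {f g : α → ℝ}, Measurable f → Measurable g →
      MemLp (f ∘ Z) 2 μ → MemLp (g ∘ Z) 2 μ → MemLp (f ∘ Z') 2 μ → MemLp (g ∘ Z') 2 μ →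
      ∀ k ≤ n, ∫ ω, (μ[f ∘ Z | B.hist k]) ω * (μ[g ∘ Z | B.hist k]) ω ∂μ
        = ∫ ω, (μ[f ∘ Z' | B.hist k]) ω * (μ[g ∘ Z' | B.hist k]) ω ∂μ := by
  induction n with
  | zero =>
    intro α _ Z Z' hZ hZ' h f g hf hg _ _ _ _ k hk
    obtain rfl : k = 0 := Nat.le_zero.1 hk
    rw [B.hist_zero]
    simp only [condExp_bot, Function.comp_apply]
    rw [integral_comp_eq_of_map_eq hZ hZ' h hf, integral_comp_eq_of_map_eq hZ hZ' h hg]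
  | succ n ih =>
    intro α _ Z Z' hZ hZ' h f g hf hg hfZ hgZ hfZ' hgZ' k hk
    have hm := B.hist_le (n + 1)
    have hW := measurable_condLaw (μ := μ) hm hZ
    have hW' := measurable_condLaw (μ := μ) hm hZ'
    have ae : ∀ {Y : Ω → α} {p : α → ℝ}, Measurable Y → Measurable p → MemLp (p ∘ Y) 2 μ →
        integralFun p ∘ condLaw (B.hist (n + 1)) μ Y =ᵐ[μ] μ[p ∘ Y | B.hist (n + 1)] :=
      fun hY hp hpY => integralFun_condLaw_ae_eq hm hY hp (hpY.integrable one_le_two)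
    have mem : ∀ {Y : Ω → α} {p : α → ℝ}, Measurable Y → Measurable p → MemLp (p ∘ Y) 2 μ →
        MemLp (integralFun p ∘ condLaw (B.hist (n + 1)) μ Y) 2 μ :=
      fun hY hp hpY => (memLp_congr_ae (ae hY hp hpY)).2 (hpY.condExp one_le_two)
    -- For `k ≤ n` the tower property replaces the variable by its conditional law and the induction
    -- hypothesis applies. For `k = n + 1` the integrand is itself a function of the conditional
    -- law, so equality of laws suffices.
    rcases Nat.le_succ_iff.1 hk with hk' | rfl
    · have tower : ∀ {Y : Ω → α} {p : α → ℝ}, Measurable Y → Measurable p →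
          MemLp (p ∘ Y) 2 μ → μ[p ∘ Y | B.hist k]
            =ᵐ[μ] μ[integralFun p ∘ condLaw (B.hist (n + 1)) μ Y | B.hist k] := fun hY hp hpY =>
        (condExp_condExp_of_le (B.hist_mono hk) hm).symm.trans
          (condExp_congr_ae (ae hY hp hpY)).symm
      have key : ∀ {Y : Ω → α}, Measurable Y → MemLp (f ∘ Y) 2 μ → MemLp (g ∘ Y) 2 μ →
          ∫ ω, (μ[f ∘ Y | B.hist k]) ω * (μ[g ∘ Y | B.hist k]) ω ∂μ =
          ∫ ω, (μ[integralFun f ∘ condLaw (B.hist (n + 1)) μ Y | B.hist k]) ω *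
            (μ[integralFun g ∘ condLaw (B.hist (n + 1)) μ Y | B.hist k]) ω ∂μ := by
        intro Y hY h1 h2
        refine integral_congr_ae ?_
        filter_upwards [tower hY hf h1, tower hY hg h2] with ω e1 e2
        rw [e1, e2]
      rw [key hZ hfZ hgZ, key hZ' hfZ' hgZ']
      exact ih hW hW' h (measurable_integralFun hf) (measurable_integralFun hg) (mem hZ hf hfZ)
        (mem hZ hg hgZ) (mem hZ' hf hfZ') (mem hZ' hg hgZ') k hk'
    · have key : ∀ {Y : Ω → α}, Measurable Y → MemLp (f ∘ Y) 2 μ → MemLp (g ∘ Y) 2 μ →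
          ∫ ω, (μ[f ∘ Y | B.hist (n + 1)]) ω * (μ[g ∘ Y | B.hist (n + 1)]) ω ∂μ =
          ∫ ω, integralFun f (condLaw (B.hist (n + 1)) μ Y ω) *
            integralFun g (condLaw (B.hist (n + 1)) μ Y ω) ∂μ := by
        intro Y hY h1 h2
        refine integral_congr_ae ?_
        filter_upwards [ae hY hf h1, ae hY hg h2] with ω e1 e2
        rw [← e1, ← e2]
        rfl
      rw [key hZ hfZ hgZ, key hZ' hfZ' hgZ']
      exact integral_comp_eq_of_map_eq hW hW' (SameNestedLaw.map_eq n hW hW' h)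
        ((measurable_integralFun hf).mul (measurable_integralFun hg))

end NestedLaw

/-! ### Conditional laws of the noise and invariance under rotations -/

section Rotation

/-- The path which agrees with `x` before time `n` and with `y` from time `n` on. -/
def splice {T d : ℕ} (n : ℕ) (x y : Path T d) : Path T d := fun t => if (t : ℕ) < n then x t else y t

theorem measurable_splice {T d : ℕ} (n : ℕ) :
    Measurable fun p : Path T d × Path T d => splice n p.1 p.2 := by
  refine measurable_pi_lambda _ fun t => ?_
  by_cases h : (t : ℕ) < n
  · simp only [splice, h, if_true]; fun_prop
  · simp only [splice, h, if_false]; fun_prop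

/-- The law of `T` independent standard Gaussian vectors in `ℝ^d`. -/
def noiseLaw (T d : ℕ) : Measure (Path T d) :=
  Measure.pi fun _ => stdGaussian (EuclideanSpace ℝ (Fin d))

instance (T d : ℕ) : IsProbabilityMeasure (noiseLaw T d) := by
  unfold noiseLaw; infer_instance

/-- Resampling the coordinates from time `n` on by an independent copy preserves a product measure;
it is enough to test boxes. -/
theorem map_splice_noiseLaw (T d n : ℕ) :
    ((noiseLaw T d).prod (noiseLaw T d)).map (fun p => splice n p.1 p.2) = noiseLaw T d := by
  refine (Measure.pi_eq fun s hs => ?_).symm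
  rw [Measure.map_apply (measurable_splice n) (MeasurableSet.univ_pi hs)]
  have h : (fun p : Path T d × Path T d => splice n p.1 p.2) ⁻¹' Set.univ.pi s
      = (Set.univ.pi fun t : Fin T => if (t : ℕ) < n then s t else Set.univ) ×ˢ
        (Set.univ.pi fun t : Fin T => if (t : ℕ) < n then Set.univ else s t) := by
    ext ⟨x, y⟩
    simp only [Set.mem_preimage, Set.mem_pi, Set.mem_univ, true_imp_iff, Set.mem_prod, splice,
      ← forall_and]
    refine forall_congr' fun t => ?_
    split_ifs <;> simp
  rw [h, Measure.prod_prod]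
  simp only [noiseLaw, Measure.pi_pi, ← Finset.prod_mul_distrib]
  refine Finset.prod_congr rfl fun t _ => ?_
  split_ifs <;> simp

/-- The law of the noise given that it agrees with `x` before time `n`. -/
def spliceLaw {T d : ℕ} (n : ℕ) (x : Path T d) : Measure (Path T d) :=
  (noiseLaw T d).map (splice n x)

theorem measurable_spliceLaw {T d : ℕ} (n : ℕ) : Measurable (spliceLaw (T := T) (d := d) n) := by
  have h : spliceLaw (T := T) (d := d) n
      = fun x => ((noiseLaw T d).map (Prod.mk x)).map fun p => splice n p.1 p.2 := by
    funext x
    rw [Measure.map_map (measurable_splice n) measurable_prodMk_left]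
    rfl
  rw [h]
  exact (Measure.measurable_map _ (measurable_splice n)).comp Measurable.map_prodMk_left

instance {T d : ℕ} (n : ℕ) (x : Path T d) : IsProbabilityMeasure (spliceLaw n x) :=
  Measure.isProbabilityMeasure_map
    ((measurable_splice n).comp measurable_prodMk_left).aemeasurable

variable {Ω : Type*} {m : MeasurableSpace Ω} [mΩ : MeasurableSpace Ω] {μ : Measure Ω} {T d : ℕ}

/-- The path of the Gaussian noise. -/
def GaussianBasis.noise (B : GaussianBasis μ T d) (ω : Ω) : Path T d := fun t => B.G t ω

theorem GaussianBasis.measurable_noise (B : GaussianBasis μ T d) : Measurable B.noise :=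
  measurable_pi_lambda _ B.measurable

variable [StandardBorelSpace Ω] [IsProbabilityMeasure μ]

theorem GaussianBasis.map_noise (B : GaussianBasis μ T d) : μ.map B.noise = noiseLaw T d := by
  have := (iIndepFun_iff_map_fun_eq_pi_map fun t => (B.measurable t).aemeasurable).1 B.indep
  simp only [B.law] at this
  exact this

theorem GaussianBasis.measurable_splice_noise (B : GaussianBasis μ T d) (n : ℕ) (y : Path T d) :
    Measurable[B.hist n] fun ω => splice n (B.noise ω) y := by
  refine @measurable_pi_lambda _ _ _ (B.hist n) _ _ fun t => ?_
  by_cases h : (t : ℕ) < n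
  · simp only [splice, h, if_true]
    exact measurable_G_hist B h
  · simp only [splice, h, if_false]
    exact @measurable_const _ _ _ (B.hist n) _

/-- Every event of the history is thus a preimage under the noise stopped at `n`, which transports
integrals over such events to path space. -/
theorem GaussianBasis.hist_le_comap (B : GaussianBasis μ T d) (n : ℕ) :
    B.hist n ≤ MeasurableSpace.comap (fun ω => splice n (B.noise ω) 0) inferInstance := by
  refine iSup₂_le fun s hs => ?_
  have h : B.G s = (fun x : Path T d => x s) ∘ fun ω => splice n (B.noise ω) 0 := by
    funext ω
    simp [splice, hs, noise]
  rw [h, ← MeasurableSpace.comap_comp]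
  exact MeasurableSpace.comap_mono (measurable_pi_apply s).comap_le

theorem splice_splice {n : ℕ} (x y z : Path T d) : splice n (splice n x y) z = splice n x z := by
  funext t
  simp only [splice]
  split_ifs <;> rfl

/-- The regular conditional law of the noise given its history. -/
theorem GaussianBasis.condLaw_noise (B : GaussianBasis μ T d) (n : ℕ) :
    condLaw (B.hist n) μ B.noise =ᵐ[μ] fun ω => spliceLaw n (B.noise ω) := by
  have hm := B.hist_le n
  have hG := B.measurable_noise
  let κ₁ : @Kernel Ω (Path T d) (B.hist n) _ := (condExpKernel μ (B.hist n)).map B.noise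
  -- The coordinates from `n` on are overwritten by `0` to make the kernel visibly `B.hist
  -- n`-measurable; `spliceLaw` ignores them anyway.
  let κ₂ : @Kernel Ω (Path T d) (B.hist n) _ :=
    @Kernel.mk Ω (Path T d) (B.hist n) _ (fun ω => spliceLaw n (splice n (B.noise ω) 0))
      ((measurable_spliceLaw n).comp (B.measurable_splice_noise n 0))
  have hκ₁ : IsMarkovKernel κ₁ := Kernel.IsMarkovKernel.map _ hG
  have hκ₂ : IsMarkovKernel κ₂ := ⟨fun ω => by
    change IsProbabilityMeasure (spliceLaw n (splice n (B.noise ω) 0)); infer_instance⟩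
  have hκ₂' : ∀ ω, κ₂ ω = spliceLaw n (B.noise ω) := fun ω => by
    change spliceLaw n (splice n (B.noise ω) 0) = _
    unfold spliceLaw
    congr 1
    funext y
    exact splice_splice _ _ _
  -- Kernels into a standard Borel space are almost surely equal once their composition products
  -- with the base measure agree, and rectangles suffice for this.
  have key : (μ.trim hm) ⊗ₘ κ₁ = (μ.trim hm) ⊗ₘ κ₂ := by
    refine Measure.ext_prod fun {s A} hs hA => ?_
    rw [Measure.compProd_apply_prod hs hA, Measure.compProd_apply_prod hs hA]
    have e1 : ∫⁻ ω in s, κ₁ ω A ∂(μ.trim hm) = μ (s ∩ B.noise ⁻¹' A) := by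
      have : ∀ ω, κ₁ ω A = condExpKernel μ (B.hist n) ω (B.noise ⁻¹' A) := fun ω =>
        Kernel.map_apply' _ hG _ hA
      simp only [this]
      rw [← Measure.compProd_apply_prod hs (hG hA), compProd_trim_condExpKernel hm,
        @Measure.map_apply _ _ mΩ ((B.hist n).prod mΩ) _ _ ?_ _ ?_]
      · rfl
      · exact @Measurable.prodMk _ mΩ _ _ (B.hist n) mΩ _ _ (measurable_id'' hm) measurable_id
      · exact @MeasurableSet.prod _ _ (B.hist n) mΩ _ _ hs (hG hA)
    obtain ⟨C, hC, rfl⟩ := B.hist_le_comap n s hs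
    have hC' : MeasurableSet ((fun x : Path T d => splice n x 0) ⁻¹' C) :=
      ((measurable_splice n).comp measurable_prodMk_right) hC
    have hmeas : Measurable fun x : Path T d => spliceLaw n x A :=
      (Measure.measurable_coe hA).comp (measurable_spliceLaw n)
    have e2 : ∫⁻ ω in (fun ω => splice n (B.noise ω) 0) ⁻¹' C, κ₂ ω A ∂(μ.trim hm)
        = μ ((fun ω => splice n (B.noise ω) 0) ⁻¹' C ∩ B.noise ⁻¹' A) := by
      rw [← lintegral_indicator hs, lintegral_trim hm ((κ₂.measurable_coe hA).indicator hs),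
        lintegral_indicator (hm _ hs)]
      simp only [hκ₂']
      calc ∫⁻ ω in (fun ω => splice n (B.noise ω) 0) ⁻¹' C, spliceLaw n (B.noise ω) A ∂μ
          = ∫⁻ x in (fun x : Path T d => splice n x 0) ⁻¹' C, spliceLaw n x A ∂(noiseLaw T d) := by
            rw [← B.map_noise, setLIntegral_map hC' hmeas hG]
            rfl
        _ = ((noiseLaw T d).prod (noiseLaw T d)) ((fun p => splice n p.1 p.2) ⁻¹'
              ((fun x : Path T d => splice n x 0) ⁻¹' C ∩ A)) := by
            rw [Measure.prod_apply (measurable_splice n (hC'.inter hA)), ← lintegral_indicator hC']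
            refine lintegral_congr fun x => ?_
            have hx : Measurable (splice n x) := (measurable_splice n).comp measurable_prodMk_left
            by_cases hxC : x ∈ (fun x : Path T d => splice n x 0) ⁻¹' C
            · rw [Set.indicator_of_mem hxC, spliceLaw, Measure.map_apply hx hA]
              congr 1
              ext y
              rw [Set.mem_preimage] at hxC
              simp [splice_splice, hxC]
            · rw [Set.indicator_of_notMem hxC]
              symm
              convert measure_empty (μ := noiseLaw T d)
              ext y
              rw [Set.mem_preimage] at hxC
              simp [splice_splice, hxC]
        _ = _ := by
            rw [← Measure.map_apply (measurable_splice n) (hC'.inter hA), map_splice_noiseLaw,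
              ← B.map_noise, Measure.map_apply hG (hC'.inter hA)]
            rfl
    rw [e1, e2]
  have hae := ae_of_ae_trim hm (Kernel.ae_eq_of_compProd_eq key)
  filter_upwards [hae] with ω hω
  rw [← hκ₂', ← hω]
  exact (Kernel.map_apply _ hG ω).symm

/-- The same functional of two Gaussian bases with the same filtration has the same nested law. -/
theorem sameNestedLaw_of_hist_eq {B B' : GaussianBasis μ T d} (hB : ∀ n, B'.hist n = B.hist n)
    (n : ℕ) : ∀ {α : Type} [MeasurableSpace α] {Φ : Path T d → α}, Measurable Φ →
      ∀ {Z Z' : Ω → α}, Z =ᵐ[μ] Φ ∘ B.noise → Z' =ᵐ[μ] Φ ∘ B'.noise → SameNestedLaw B n Z Z' := by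
  induction n with
  | zero =>
    intro α _ Φ hΦ Z Z' hZ hZ'
    change μ.map Z = μ.map Z'
    rw [Measure.map_congr hZ, Measure.map_congr hZ', ← Measure.map_map hΦ B.measurable_noise,
      ← Measure.map_map hΦ B'.measurable_noise, B.map_noise, B'.map_noise]
  | succ n ih =>
    intro α _ Φ hΦ Z Z' hZ hZ'
    -- Conditioning turns a functional `Φ` of the noise into another functional of the noise, the
    -- same for every Gaussian basis. The induction therefore runs over arbitrary targets and
    -- functionals.
    have key : ∀ (A : GaussianBasis μ T d) {Y : Ω → α}, Y =ᵐ[μ] Φ ∘ A.noise →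
        condLaw (A.hist (n + 1)) μ Y
          =ᵐ[μ] (fun x => (spliceLaw (n + 1) x).map Φ) ∘ A.noise := by
      intro A Y hY
      filter_upwards [condLaw_congr_ae (A.hist_le (n + 1)) hY, A.condLaw_noise (n + 1)]
        with ω h1 h2
      rw [h1, Function.comp_apply, ← h2]
      exact (Measure.map_map hΦ A.measurable_noise).symm
    exact ih ((Measure.measurable_map Φ hΦ).comp (measurable_spliceLaw (n + 1))) (key B hZ)
      (hB (n + 1) ▸ key B' hZ')

/-- The Gaussian basis obtained by rotating each Gaussian vector. -/
def GaussianBasis.rotate (B : GaussianBasis μ T d)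
    (O : Fin T → EuclideanSpace ℝ (Fin d) ≃ₗᵢ[ℝ] EuclideanSpace ℝ (Fin d)) :
    GaussianBasis μ T d where
  G t ω := O t (B.G t ω)
  measurable t := (O t).continuous.measurable.comp (B.measurable t)
  law t := by
    have h := Measure.map_map (O t).continuous.measurable (B.measurable t) (μ := μ)
    rw [B.law, stdGaussian_map] at h
    exact h.symm
  indep := B.indep.comp (fun t => O t) fun t => (O t).continuous.measurable

/-- An isometry is a measurable equivalence, so `G t` and its rotation generate the same σ-algebra.
-/
theorem GaussianBasis.hist_rotate (B : GaussianBasis μ T d)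
    (O : Fin T → EuclideanSpace ℝ (Fin d) ≃ₗᵢ[ℝ] EuclideanSpace ℝ (Fin d)) (n : ℕ) :
    (B.rotate O).hist n = B.hist n := by
  refine iSup_congr fun t => iSup_congr fun _ => ?_
  have h : (B.rotate O).G t = O t ∘ B.G t := rfl
  rw [h, ← MeasurableSpace.comap_comp]
  congr 1
  exact (O t).toHomeomorph.toMeasurableEquiv.measurableEmbedding.comap_eq

end Rotation

/-! ### The block-orthogonal group and the quotient of the Frobenius distance -/

section Frobenius

variable {T d : ℕ}

/-! ### Block-orthogonal matrices -/

theorem exists_isometry_of_mem_orthogonalGroup {Q : Matrix (Fin d) (Fin d) ℝ}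
    (hQ : Q ∈ Matrix.orthogonalGroup (Fin d) ℝ) :
    ∃ O : EuclideanSpace ℝ (Fin d) ≃ₗᵢ[ℝ] EuclideanSpace ℝ (Fin d),
      ∀ x, O x = Matrix.toEuclideanCLM (𝕜 := ℝ) Q x :=
  ⟨Unitary.linearIsometryEquiv (𝕜 := ℝ) ⟨Matrix.toEuclideanCLM (𝕜 := ℝ) Q,
    Unitary.map_mem (Matrix.toEuclideanCLM (n := Fin d) (𝕜 := ℝ)) hQ⟩, fun _ => rfl⟩

theorem exists_mem_orthogonalGroup_of_isometry
    (O : EuclideanSpace ℝ (Fin d) ≃ₗᵢ[ℝ] EuclideanSpace ℝ (Fin d)) :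
    ∃ Q ∈ Matrix.orthogonalGroup (Fin d) ℝ, ∀ x, O x = Matrix.toEuclideanCLM (𝕜 := ℝ) Q x := by
  let U := Unitary.linearIsometryEquiv.symm O
  refine ⟨(Matrix.toEuclideanCLM (n := Fin d) (𝕜 := ℝ)).symm U.1,
    Unitary.map_mem (Matrix.toEuclideanCLM (n := Fin d) (𝕜 := ℝ)).symm U.2, fun x => ?_⟩
  rw [StarAlgEquiv.apply_symm_apply]
  rfl

/-- The block-diagonal matrix with the given diagonal blocks. -/
def blockDiag (Q : Fin T → Matrix (Fin d) (Fin d) ℝ) : BlockLower T d :=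
  ⟨Matrix.diagonal Q, fun _ _ h => Matrix.diagonal_apply_ne _ h.ne⟩

theorem mem_blockOrth_iff {O : BlockLower T d} :
    O ∈ BlockOrth T d ↔
      ∃ Q : Fin T → Matrix (Fin d) (Fin d) ℝ,
        (∀ t, Q t ∈ Matrix.orthogonalGroup (Fin d) ℝ) ∧ O = blockDiag Q :=
  exists_congr fun Q => and_congr_right fun _ =>
    (Subtype.ext_iff (a1 := O) (a2 := blockDiag Q)).symm

theorem mul_blockDiag_apply (A : BlockLower T d) (Q : Fin T → Matrix (Fin d) (Fin d) ℝ)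
    (t s : Fin T) :
    ((A * blockDiag Q : BlockLower T d) : BlockMatrix T d) t s
      = (A : BlockMatrix T d) t s * Q s :=
  Matrix.mul_diagonal _ _ _ _

theorem one_mem_blockOrth : (1 : BlockLower T d) ∈ BlockOrth T d :=
  ⟨fun _ => 1, fun _ => one_mem _, Matrix.diagonal_one.symm⟩

theorem mul_mem_blockOrth {O P : BlockLower T d} (hO : O ∈ BlockOrth T d)
    (hP : P ∈ BlockOrth T d) : O * P ∈ BlockOrth T d := by
  obtain ⟨Q, hQ, h⟩ := hO
  obtain ⟨R, hR, h'⟩ := hP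
  refine ⟨fun t => Q t * R t, fun t => mul_mem (hQ t) (hR t), ?_⟩
  change (O : BlockMatrix T d) * (P : BlockMatrix T d) = _
  rw [h, h', Matrix.diagonal_mul_diagonal]

theorem exists_mul_eq_one_of_mem_blockOrth {O : BlockLower T d} (hO : O ∈ BlockOrth T d) :
    ∃ P ∈ BlockOrth T d, O * P = 1 := by
  obtain ⟨Q, hQ, h⟩ := hO
  refine ⟨blockDiag fun t => star (Q t), ⟨_, fun t => Unitary.star_mem (hQ t), rfl⟩,
    Subtype.ext ?_⟩
  change (O : BlockMatrix T d) * Matrix.diagonal (fun t => star (Q t)) = 1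
  rw [h, Matrix.diagonal_mul_diagonal, ← Matrix.diagonal_one]
  congr 1
  funext t
  exact (Unitary.mem_iff.1 (hQ t)).2

theorem isCompact_orthogonalGroup :
    IsCompact {Q : Matrix (Fin d) (Fin d) ℝ | Q ∈ Matrix.orthogonalGroup (Fin d) ℝ} := by
  have hsub : {Q : Matrix (Fin d) (Fin d) ℝ | Q ∈ Matrix.orthogonalGroup (Fin d) ℝ} ⊆
      Set.univ.pi fun _ => Set.univ.pi fun _ => Metric.closedBall (0 : ℝ) 1 := by
    intro Q hQ i _ j _
    rw [mem_closedBall_zero_iff]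
    exact entry_norm_bound_of_unitary hQ i j
  refine IsCompact.of_isClosed_subset (isCompact_univ_pi fun _ => isCompact_univ_pi fun _ =>
    isCompact_closedBall _ _) ?_ hsub
  simp only [Matrix.mem_orthogonalGroup_iff]
  exact isClosed_eq (by fun_prop) continuous_const

theorem isCompact_blockOrth : IsCompact (BlockOrth T d) := by
  have h : BlockOrth T d = blockDiag '' Set.univ.pi fun _ =>
      {Q : Matrix (Fin d) (Fin d) ℝ | Q ∈ Matrix.orthogonalGroup (Fin d) ℝ} := by
    ext O
    rw [mem_blockOrth_iff]
    simp only [Set.mem_image, Set.mem_pi, Set.mem_univ, true_imp_iff, Set.mem_ofPred_eq]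
    exact exists_congr fun Q => and_congr_right fun _ => eq_comm
  rw [h]
  refine (isCompact_univ_pi fun _ => isCompact_orthogonalGroup).image ?_
  exact Continuous.subtype_mk continuous_id.matrix_diagonal _

/-! ### Rows and the Frobenius norm -/

/-- The row with index `i.2` of the block `A_{i.1, s}`. -/
def row (A : BlockLower T d) (s : Fin T) (i : Fin T × Fin d) : EuclideanSpace ℝ (Fin d) :=
  WithLp.toLp 2 ((A : BlockMatrix T d) i.1 s i.2)

theorem row_sub (A A' : BlockLower T d) (s : Fin T) (i : Fin T × Fin d) :
    row (A - A') s i = row A s i - row A' s i := rfl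

/-- Multiplication on the right acts on row vectors, so it becomes the action of the transposed
block on columns; hence the `star`. -/
theorem row_mul_blockDiag (A : BlockLower T d) (Q : Fin T → Matrix (Fin d) (Fin d) ℝ)
    (s : Fin T) (i : Fin T × Fin d) :
    row (A * blockDiag Q) s i = Matrix.toEuclideanCLM (𝕜 := ℝ) (star (Q s)) (row A s i) := by
  rw [row, row, Matrix.toEuclideanCLM_toLp, mul_blockDiag_apply, Matrix.star_eq_conjTranspose,
    Matrix.conjTranspose_eq_transpose_of_trivial, Matrix.mulVec_transpose]
  rfl

theorem exists_isometry_row_mul {P : BlockLower T d} (hP : P ∈ BlockOrth T d) :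
    ∃ O : Fin T → EuclideanSpace ℝ (Fin d) ≃ₗᵢ[ℝ] EuclideanSpace ℝ (Fin d),
      ∀ A s i, row (A * P) s i = O s (row A s i) := by
  obtain ⟨Q, hQ, rfl⟩ := mem_blockOrth_iff.1 hP
  choose O hO using fun s => exists_isometry_of_mem_orthogonalGroup (Unitary.star_mem (hQ s))
  exact ⟨O, fun A s i => by rw [row_mul_blockDiag, hO]⟩

theorem exists_mem_blockOrth_row_mul
    (O : Fin T → EuclideanSpace ℝ (Fin d) ≃ₗᵢ[ℝ] EuclideanSpace ℝ (Fin d)) :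
    ∃ P ∈ BlockOrth T d, ∀ A s i, row (A * P) s i = O s (row A s i) := by
  choose Q hQ hO using fun s => exists_mem_orthogonalGroup_of_isometry (O s)
  refine ⟨blockDiag fun s => star (Q s),
    mem_blockOrth_iff.2 ⟨_, fun s => Unitary.star_mem (hQ s), rfl⟩, fun A s i => ?_⟩
  rw [row_mul_blockDiag, hO, star_star]

theorem exists_isometry_toEuclideanCLM_mul {P : BlockLower T d} (hP : P ∈ BlockOrth T d) :
    ∃ O : Fin T → EuclideanSpace ℝ (Fin d) ≃ₗᵢ[ℝ] EuclideanSpace ℝ (Fin d),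
      ∀ (A : BlockLower T d) t s x,
        Matrix.toEuclideanCLM (𝕜 := ℝ) (((A * P : BlockLower T d) : BlockMatrix T d) t s) x
          = Matrix.toEuclideanCLM (𝕜 := ℝ) ((A : BlockMatrix T d) t s) (O s x) := by
  obtain ⟨Q, hQ, rfl⟩ := mem_blockOrth_iff.1 hP
  choose O hO using fun s => exists_isometry_of_mem_orthogonalGroup (hQ s)
  refine ⟨O, fun A t s x => ?_⟩
  rw [mul_blockDiag_apply, map_mul, hO]
  rfl

theorem frobSq_eq_sum_row (A : BlockLower T d) : frobSq A = ∑ s, ∑ i, ‖row A s i‖ ^ 2 := by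
  simp only [frobSq, row, EuclideanSpace.real_norm_sq_eq, Fintype.sum_prod_type]
  exact Finset.sum_comm

theorem frobSq_mul {P : BlockLower T d} (hP : P ∈ BlockOrth T d) (A : BlockLower T d) :
    frobSq (A * P) = frobSq A := by
  obtain ⟨O, hO⟩ := exists_isometry_row_mul hP
  simp only [frobSq_eq_sum_row, hO, LinearIsometryEquiv.norm_map]

/-- The entries of a block matrix as a Euclidean vector. -/
def entries : BlockLower T d →ₗ[ℝ] EuclideanSpace ℝ ((Fin T × Fin T) × Fin d × Fin d) where
  toFun A := WithLp.toLp 2 fun i => (A : BlockMatrix T d) i.1.1 i.1.2 i.2.1 i.2.2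
  map_add' _ _ := rfl
  map_smul' _ _ := rfl

theorem entries_injective : Function.Injective (entries (T := T) (d := d)) := by
  intro A A' h
  refine Subtype.ext (Matrix.ext fun t s => Matrix.ext fun i j => ?_)
  exact congrArg (fun v : EuclideanSpace ℝ ((Fin T × Fin T) × Fin d × Fin d) => v ((t, s), i, j)) h

theorem norm_entries_sq (A : BlockLower T d) : ‖entries A‖ ^ 2 = frobSq A := by
  simp only [entries, frobSq, EuclideanSpace.real_norm_sq_eq, Fintype.sum_prod_type]
  rfl

theorem norm_entries_mul {P : BlockLower T d} (hP : P ∈ BlockOrth T d) (A : BlockLower T d) :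
    ‖entries (A * P)‖ = ‖entries A‖ := by
  rw [← sq_eq_sq₀ (norm_nonneg _) (norm_nonneg _), norm_entries_sq, norm_entries_sq, frobSq_mul hP]

theorem continuous_entries : Continuous (entries (T := T) (d := d)) := by
  refine (PiLp.continuous_toLp 2 _).comp (continuous_pi fun i => ?_)
  exact (continuous_subtype_val.matrix_elem i.1.1 i.1.2).matrix_elem i.2.1 i.2.2

/-! ### The quotient distance -/

theorem continuous_sub_mul (L M : BlockLower T d) :
    Continuous fun O : BlockLower T d => L - M * O :=
  Continuous.subtype_mk (continuous_const.sub (continuous_const.mul continuous_subtype_val)) _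

theorem exists_mem_optOrth (L M : BlockLower T d) : ∃ P, P ∈ OptOrth L M := by
  have hc : Continuous fun O : BlockLower T d => frobSq (L - M * O) := by
    simp only [← norm_entries_sq]
    exact ((continuous_entries.comp (continuous_sub_mul L M)).norm).pow 2
  obtain ⟨P, hP, h⟩ := isCompact_blockOrth.exists_isMinOn ⟨1, one_mem_blockOrth⟩ hc.continuousOn
  exact ⟨P, hP, fun O hO => h hO⟩

/-- The distance `min_O ‖L - M O‖_F` of the orbits of `L` and `M`. -/
def orbitDist (L M : BlockLower T d) : ℝ :=
  ‖entries (L - M * (exists_mem_optOrth L M).choose)‖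

theorem orbitDist_nonneg (L M : BlockLower T d) : 0 ≤ orbitDist L M := norm_nonneg _

theorem exists_orbitDist_eq (L M : BlockLower T d) :
    ∃ P ∈ BlockOrth T d, orbitDist L M = ‖entries (L - M * P)‖ :=
  ⟨_, (exists_mem_optOrth L M).choose_spec.1, rfl⟩

theorem orbitDist_le {L M O : BlockLower T d} (hO : O ∈ BlockOrth T d) :
    orbitDist L M ≤ ‖entries (L - M * O)‖ := by
  refine (sq_le_sq₀ (norm_nonneg _) (norm_nonneg _)).1 ?_
  rw [norm_entries_sq, norm_entries_sq]
  exact (exists_mem_optOrth L M).choose_spec.2 O hO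

theorem orbitDist_le_norm_sub (L M : BlockLower T d) : orbitDist L M ≤ ‖entries (L - M)‖ := by
  simpa using orbitDist_le (L := L) (M := M) one_mem_blockOrth

theorem mem_optOrth_iff {L M P : BlockLower T d} :
    P ∈ OptOrth L M ↔ P ∈ BlockOrth T d ∧ ‖entries (L - M * P)‖ = orbitDist L M := by
  refine and_congr_right fun hP => ⟨fun h => le_antisymm ?_ (orbitDist_le hP), fun h O hO => ?_⟩
  · obtain ⟨O, hO, h'⟩ := exists_orbitDist_eq L M
    rw [h']
    refine (sq_le_sq₀ (norm_nonneg _) (norm_nonneg _)).1 ?_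
    rw [norm_entries_sq, norm_entries_sq]
    exact h O hO
  · rw [← norm_entries_sq, ← norm_entries_sq, h]
    exact pow_le_pow_left₀ (orbitDist_nonneg _ _) (orbitDist_le hO) 2

/-- A closed condition inside a compact group. This is the compactness behind a choice of `P`
independent of time. -/
theorem isCompact_optOrth (L M : BlockLower T d) : IsCompact (OptOrth L M) := by
  have h : OptOrth L M =
      BlockOrth T d ∩ (fun P => ‖entries (L - M * P)‖) ⁻¹' {orbitDist L M} := by
    ext P
    exact mem_optOrth_iff
  rw [h]
  refine isCompact_blockOrth.inter_right (isClosed_singleton.preimage ?_)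
  exact (continuous_entries.comp (continuous_sub_mul L M)).norm

theorem norm_entries_sub_comm (L M : BlockLower T d) :
    ‖entries (L - M)‖ = ‖entries (M - L)‖ := by
  rw [map_sub, map_sub, norm_sub_rev]

theorem orbitDist_mul_right {L M O : BlockLower T d} (hO : O ∈ BlockOrth T d) :
    orbitDist L (M * O) = orbitDist L M := by
  refine le_antisymm ?_ ?_
  · obtain ⟨P, hP, h⟩ := exists_orbitDist_eq L M
    obtain ⟨O', hO', h1⟩ := exists_mul_eq_one_of_mem_blockOrth hO
    rw [h]
    have := orbitDist_le (L := L) (M := M * O) (mul_mem_blockOrth hO' hP)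
    rwa [mul_assoc, ← mul_assoc O, h1, one_mul] at this
  · obtain ⟨P, hP, h⟩ := exists_orbitDist_eq L (M * O)
    rw [h, mul_assoc]
    exact orbitDist_le (mul_mem_blockOrth hO hP)

theorem orbitDist_comm (L M : BlockLower T d) : orbitDist L M = orbitDist M L := by
  have key : ∀ L M : BlockLower T d, orbitDist L M ≤ orbitDist M L := by
    intro L M
    obtain ⟨P, hP, h⟩ := exists_orbitDist_eq M L
    rw [h, norm_entries_sub_comm]
    obtain ⟨P', hP', h1⟩ := exists_mul_eq_one_of_mem_blockOrth hP
    rw [← norm_entries_mul hP', sub_mul, mul_assoc, h1, mul_one]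
    exact orbitDist_le hP'
  exact le_antisymm (key L M) (key M L)

theorem orbitDist_mul_left {L M O : BlockLower T d} (hO : O ∈ BlockOrth T d) :
    orbitDist (L * O) M = orbitDist L M := by
  rw [orbitDist_comm, orbitDist_mul_right hO, orbitDist_comm]

/-- Since the action is isometric, the second optimal pair can be rotated so that both pairs share
the midpoint `M * P`: `L - N Q P = (L - M P) + (M - N Q) P`. -/
theorem orbitDist_triangle (L M N : BlockLower T d) :
    orbitDist L N ≤ orbitDist L M + orbitDist M N := by
  obtain ⟨P, hP, h⟩ := exists_orbitDist_eq L M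
  obtain ⟨Q, hQ, h'⟩ := exists_orbitDist_eq M N
  rw [h, h', ← norm_entries_mul hP (M - N * Q)]
  refine (orbitDist_le (mul_mem_blockOrth hQ hP)).trans ?_
  refine le_trans (le_of_eq ?_) (norm_add_le _ _)
  rw [← map_add]
  congr 2
  rw [sub_mul, mul_assoc]
  abel

end Frobenius

/-! ### Martingale increments in `L²` -/

section L2

variable {Ω : Type*} [mΩ : MeasurableSpace Ω] {μ : Measure Ω}

theorem inner_toLp {f g : Ω → ℝ} (hf : MemLp f 2 μ) (hg : MemLp g 2 μ) :
    ⟪hf.toLp f, hg.toLp g⟫_ℝ = ∫ ω, f ω * g ω ∂μ := by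
  rw [L2.inner_def]
  refine integral_congr_ae ?_
  filter_upwards [hf.coeFn_toLp, hg.coeFn_toLp] with ω h1 h2
  rw [h1, h2, real_inner_eq_re_inner, RCLike.inner_apply]
  simp [mul_comm]

theorem toLp_sum {ι : Type*} (s : Finset ι) (c : ι → ℝ) {f : ι → Ω → ℝ}
    (hf : ∀ j, MemLp (f j) 2 μ) (h : MemLp (fun ω => ∑ j ∈ s, c j * f j ω) 2 μ) :
    h.toLp _ = ∑ j ∈ s, c j • (hf j).toLp (f j) := by
  classical
  induction s using Finset.induction_on with
  | empty => simp only [Finset.sum_empty]; rfl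
  | insert a s ha ih =>
    have h' : MemLp (fun ω => ∑ j ∈ s, c j * f j ω) 2 μ :=
      memLp_finsetSum s fun j _ => (hf j).const_mul (c j)
    rw [Finset.sum_insert ha, ← ih h', ← MemLp.toLp_const_smul, ← MemLp.toLp_add]
    refine MemLp.toLp_congr _ _ (Filter.Eventually.of_forall fun ω => ?_)
    simp [Finset.sum_insert ha]

variable [StandardBorelSpace Ω] [IsProbabilityMeasure μ] {T d : ℕ}

/-- The conditional expectation given the history up to time `k`, as a projection of `L²`. -/
def GaussianBasis.proj (B : GaussianBasis μ T d) (k : ℕ) : Lp ℝ 2 μ →L[ℝ] Lp ℝ 2 μ :=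
  (lpMeas ℝ ℝ (B.hist k) 2 μ).subtypeL.comp (condExpL2 ℝ ℝ (B.hist_le k))

theorem GaussianBasis.inner_proj_proj (B : GaussianBasis μ T d) {j k : ℕ} (h : j ≤ k)
    (x y : Lp ℝ 2 μ) : ⟪B.proj k x, B.proj j y⟫_ℝ = ⟪B.proj j x, B.proj j y⟫_ℝ := by
  have hm : AEStronglyMeasurable[B.hist j] (B.proj j y) μ :=
    aestronglyMeasurable_condExpL2 (B.hist_le j) y
  exact (inner_condExpL2_eq_inner_fun (𝕜 := ℝ) (B.hist_le k) x (B.proj j y)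
      (hm.mono (B.hist_mono h))).trans
    (inner_condExpL2_eq_inner_fun (𝕜 := ℝ) (B.hist_le j) x (B.proj j y) hm).symm

theorem GaussianBasis.proj_toLp (B : GaussianBasis μ T d) (k : ℕ) {f : Ω → ℝ}
    (hf : MemLp f 2 μ) :
    B.proj k (hf.toLp f) = (hf.condExp (m := B.hist k) one_le_two).toLp _ := by
  refine Lp.ext ?_
  exact (hf.condExpL2_ae_eq_condExp (𝕜 := ℝ) (B.hist_le k)).trans (MemLp.coeFn_toLp _).symm

theorem GaussianBasis.proj_toLp_of_measurable (B : GaussianBasis μ T d) (k : ℕ) {f : Ω → ℝ}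
    (hf : MemLp f 2 μ) (hm : Measurable[B.hist k] f) : B.proj k (hf.toLp f) = hf.toLp f := by
  rw [B.proj_toLp]
  refine MemLp.toLp_congr _ _ ?_
  rw [condExp_of_stronglyMeasurable (B.hist_le k) hm.stronglyMeasurable
    (hf.integrable one_le_two)]

/-- The martingale increment at time `k`. -/
def GaussianBasis.incr (B : GaussianBasis μ T d) (k : ℕ) : Lp ℝ 2 μ →L[ℝ] Lp ℝ 2 μ :=
  B.proj (k + 1) - B.proj k

/-- The projections are nested, so mixed terms collapse. Gram matrices of increments thereby reduce
to second moments of conditional expectations. -/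
theorem GaussianBasis.inner_incr (B : GaussianBasis μ T d) (k : ℕ) (x y : Lp ℝ 2 μ) :
    ⟪B.incr k x, B.incr k y⟫_ℝ = ⟪B.proj (k + 1) x, B.proj (k + 1) y⟫_ℝ
      - ⟪B.proj k x, B.proj k y⟫_ℝ := by
  have h1 := B.inner_proj_proj k.le_succ x y
  have h2 := B.inner_proj_proj k.le_succ y x
  rw [real_inner_comm, real_inner_comm (B.proj k x)] at h2
  simp only [incr, sub_apply, inner_sub_left, inner_sub_right] at *
  rw [h1, h2]
  ring

theorem GaussianBasis.inner_proj_eq_sum (B : GaussianBasis μ T d) (n : ℕ) (x y : Lp ℝ 2 μ) :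
    ⟪B.proj n x, B.proj n y⟫_ℝ
      = ⟪B.proj 0 x, B.proj 0 y⟫_ℝ + ∑ k : Fin n, ⟪B.incr k x, B.incr k y⟫_ℝ := by
  rw [Fin.sum_univ_eq_sum_range (fun k => ⟪B.incr k x, B.incr k y⟫_ℝ)]
  simp only [B.inner_incr]
  rw [Finset.sum_range_sub (fun k => ⟪B.proj k x, B.proj k y⟫_ℝ)]
  ring

theorem GaussianBasis.inner_proj_zero (B : GaussianBasis μ T d) {f g : Ω → ℝ} (hf : MemLp f 2 μ)
    (hg : MemLp g 2 μ) :
    ⟪B.proj 0 (hf.toLp f), B.proj 0 (hg.toLp g)⟫_ℝ = (∫ ω, f ω ∂μ) * ∫ ω, g ω ∂μ := by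
  rw [B.proj_toLp, B.proj_toLp, inner_toLp, B.hist_zero]
  simp

/-! ### The Gaussian vectors in `L²` -/

theorem GaussianBasis.memLp_coord (B : GaussianBasis μ T d) (j : Fin T × Fin d) :
    MemLp (fun ω => B.G j.1 ω j.2) 2 μ :=
  (EuclideanSpace.proj (𝕜 := ℝ) j.2).comp_memLp' (memLp_G B j.1)

/-- The entries of the Gaussian vectors as elements of `L²`. -/
def GaussianBasis.coord (B : GaussianBasis μ T d) (j : Fin T × Fin d) : Lp ℝ 2 μ :=
  (B.memLp_coord j).toLp _

theorem GaussianBasis.integral_coord (B : GaussianBasis μ T d) (j : Fin T × Fin d) :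
    ∫ ω, B.G j.1 ω j.2 ∂μ = 0 := by
  have h := integral_strongDual_stdGaussian (E := EuclideanSpace ℝ (Fin d))
    (EuclideanSpace.proj (𝕜 := ℝ) j.2)
  rw [← B.law j.1, integral_map (B.measurable j.1).aemeasurable
    (ContinuousLinearMap.continuous _).aestronglyMeasurable] at h
  exact h

/-- At equal times this is the identity covariance of the standard Gaussian; at different times,
independence and zero mean. -/
theorem GaussianBasis.orthonormal_coord (B : GaussianBasis μ T d) : Orthonormal ℝ B.coord := by
  classical
  rw [orthonormal_iff_ite]
  rintro ⟨s, p⟩ ⟨s', p'⟩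
  rw [coord, coord, inner_toLp]
  by_cases hs : s = s'
  · subst hs
    have h := covarianceBilin_apply (μ := stdGaussian (EuclideanSpace ℝ (Fin d)))
      IsGaussian.memLp_two_id (EuclideanSpace.single p 1) (EuclideanSpace.single p' 1)
    rw [covarianceBilin_stdGaussian, ← B.law s,
      integral_map (B.measurable s).aemeasurable (by fun_prop)] at h
    simp only [B.law s, id_eq, integral_id_stdGaussian, sub_zero, EuclideanSpace.inner_single_left,
      map_one, one_mul] at h
    rw [← h]
    change ⟪EuclideanSpace.single p (1 : ℝ), EuclideanSpace.single p' (1 : ℝ)⟫_ℝ = _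
    simp [EuclideanSpace.inner_single_left]
  · have hind : IndepFun (fun ω => B.G s ω p) (fun ω => B.G s' ω p') μ :=
      (B.indep.indepFun hs).comp (φ := fun x : EuclideanSpace ℝ (Fin d) => x p)
        (ψ := fun x : EuclideanSpace ℝ (Fin d) => x p') (by fun_prop) (by fun_prop)
    rw [hind.integral_fun_mul_eq_mul_integral (B.memLp_coord (s, p)).aestronglyMeasurable
      (B.memLp_coord (s', p')).aestronglyMeasurable, B.integral_coord (s, p), zero_mul,
      if_neg fun h => hs (Prod.ext_iff.1 h).1]

/-- Past coordinates are measurable with respect to the history; the others are independent of it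
and centered. -/
theorem GaussianBasis.proj_coord (B : GaussianBasis μ T d) (k : ℕ) (j : Fin T × Fin d) :
    B.proj k (B.coord j) = if (j.1 : ℕ) < k then B.coord j else 0 := by
  have hmeas : Measurable fun x : EuclideanSpace ℝ (Fin d) => x j.2 := by fun_prop
  split_ifs with h
  · exact B.proj_toLp_of_measurable k _ (hmeas.comp (measurable_G_hist B h))
  · have hind : Indep (MeasurableSpace.comap (B.G j.1) inferInstance) (B.hist k) μ := by
      have := indep_iSup_of_disjoint (fun s => (B.measurable s).comap_le) B.indep.iIndep
        (S := {j.1}) (T := {s : Fin T | (s : ℕ) < k}) (by simpa using h)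
      simpa [GaussianBasis.hist] using this
    rw [coord, B.proj_toLp, ← MemLp.toLp_zero (MemLp.zero' : MemLp (fun _ : Ω => (0 : ℝ)) 2 μ)]
    refine MemLp.toLp_congr _ _ ?_
    have := condExp_indep_eq (f := fun ω => B.G j.1 ω j.2) (B.measurable j.1).comap_le
      (B.hist_le k) (hmeas.comp (comap_measurable (B.G j.1))).stronglyMeasurable hind
    rw [B.integral_coord] at this
    exact this

theorem GaussianBasis.incr_coord (B : GaussianBasis μ T d) (k : ℕ) (j : Fin T × Fin d) :
    B.incr k (B.coord j) = if (j.1 : ℕ) = k then B.coord j else 0 := by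
  simp only [incr, sub_apply, B.proj_coord]
  split_ifs <;> first | omega | simp

end L2

/-! ### The adapted distance between Gaussian processes -/

section Adapted

variable {Ω : Type*} [mΩ : MeasurableSpace Ω] [StandardBorelSpace Ω]
  {μ : Measure Ω} [IsProbabilityMeasure μ] {T d : ℕ} {B : GaussianBasis μ T d}

theorem AdaptedL2.measurable_path (Z : AdaptedL2 B) : Measurable Z.path :=
  measurable_pi_lambda _ fun t => (Z.adapted t).mono (B.hist_le _) le_rfl

theorem AdaptedL2.memLp_entry (Z : AdaptedL2 B) (i : Fin T × Fin d) :
    MemLp (fun ω => Z.path ω i.1 i.2) 2 μ :=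
  (EuclideanSpace.proj (𝕜 := ℝ) i.2).comp_memLp' (Z.memLp i.1)

/-- The entries of a process as elements of `L²`. -/
def AdaptedL2.entry (Z : AdaptedL2 B) (i : Fin T × Fin d) : Lp ℝ 2 μ :=
  (Z.memLp_entry i).toLp _

theorem AdaptedL2.proj_entry (Z : AdaptedL2 B) (i : Fin T × Fin d) :
    B.proj T (Z.entry i) = Z.entry i := by
  refine B.proj_toLp_of_measurable T _ ?_
  have hmeas : Measurable fun x : EuclideanSpace ℝ (Fin d) => x i.2 := by fun_prop
  exact hmeas.comp ((Z.adapted i.1).mono (B.hist_mono i.1.isLt) le_rfl)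

theorem measurable_path_entry (i : Fin T × Fin d) :
    Measurable fun x : Path T d => x i.1 i.2 := by fun_prop

theorem AdEquiv.integral_entry_eq {Z Z' : AdaptedL2 B} (h : AdEquiv Z Z') (i : Fin T × Fin d) :
    ∫ ω, Z.path ω i.1 i.2 ∂μ = ∫ ω, Z'.path ω i.1 i.2 ∂μ :=
  integral_comp_eq_of_map_eq Z.measurable_path Z'.measurable_path
    (SameNestedLaw.map_eq _ Z.measurable_path Z'.measurable_path h) (measurable_path_entry i)

theorem AdEquiv.inner_proj_eq {Z Z' : AdaptedL2 B} (h : AdEquiv Z Z') {k : ℕ} (hk : k ≤ T)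
    (i j : Fin T × Fin d) :
    ⟪B.proj k (Z.entry i), B.proj k (Z.entry j)⟫_ℝ
      = ⟪B.proj k (Z'.entry i), B.proj k (Z'.entry j)⟫_ℝ := by
  -- The nested law conditions only up to time `T - 1`. At `k = T` the projection fixes adapted
  -- entries, so the law of the path is enough.
  rcases (show k ≤ T - 1 ∨ k = T by omega) with hk | rfl
  · simp only [AdaptedL2.entry, B.proj_toLp, inner_toLp]
    exact SameNestedLaw.integral_condExp_mul_eq (T - 1) Z.measurable_path Z'.measurable_path h
      (measurable_path_entry i) (measurable_path_entry j) (Z.memLp_entry i) (Z.memLp_entry j)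
      (Z'.memLp_entry i) (Z'.memLp_entry j) k hk
  · simp only [AdaptedL2.proj_entry]
    rw [AdaptedL2.entry, AdaptedL2.entry, AdaptedL2.entry, AdaptedL2.entry, inner_toLp, inner_toLp]
    exact integral_comp_eq_of_map_eq Z.measurable_path Z'.measurable_path
      (SameNestedLaw.map_eq _ Z.measurable_path Z'.measurable_path h)
      ((measurable_path_entry i).mul (measurable_path_entry j))

theorem AdEquiv.inner_incr_eq {Z Z' : AdaptedL2 B} (h : AdEquiv Z Z') (k : Fin T)
    (i j : Fin T × Fin d) :
    ⟪B.incr k (Z.entry i), B.incr k (Z.entry j)⟫_ℝ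
      = ⟪B.incr k (Z'.entry i), B.incr k (Z'.entry j)⟫_ℝ := by
  rw [B.inner_incr, B.inner_incr, h.inner_proj_eq k.isLt, h.inner_proj_eq k.isLt.le]

theorem AdaptedL2.inner_entry (Z Z' : AdaptedL2 B) (i j : Fin T × Fin d) :
    ⟪Z.entry i, Z'.entry j⟫_ℝ = (∫ ω, Z.path ω i.1 i.2 ∂μ) * (∫ ω, Z'.path ω j.1 j.2 ∂μ)
      + ∑ k : Fin T, ⟪B.incr k (Z.entry i), B.incr k (Z'.entry j)⟫_ℝ := by
  conv_lhs => rw [← Z.proj_entry, ← Z'.proj_entry, B.inner_proj_eq_sum]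
  rw [entry, entry, B.inner_proj_zero]

theorem cost_eq_sum_inner (X Y : AdaptedL2 B) :
    cost X Y = ∑ i, (⟪X.entry i, X.entry i⟫_ℝ - 2 * ⟪X.entry i, Y.entry i⟫_ℝ
      + ⟪Y.entry i, Y.entry i⟫_ℝ) := by
  have h : ∀ ω, ∑ t, ‖X.path ω t - Y.path ω t‖ ^ 2
      = ∑ i : Fin T × Fin d, (X.path ω i.1 i.2 - Y.path ω i.1 i.2) ^ 2 := fun ω => by
    simp only [EuclideanSpace.real_norm_sq_eq, Fintype.sum_prod_type, PiLp.sub_apply]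
  simp only [cost, h]
  rw [integral_finsetSum (f := fun (i : Fin T × Fin d) ω =>
    (X.path ω i.1 i.2 - Y.path ω i.1 i.2) ^ 2) _
    fun i _ => ((X.memLp_entry i).sub (Y.memLp_entry i)).integrable_sq]
  refine Finset.sum_congr rfl fun i _ => ?_
  rw [real_inner_self_eq_norm_sq, real_inner_self_eq_norm_sq, ← norm_sub_sq_real,
    ← real_inner_self_eq_norm_sq, AdaptedL2.entry, AdaptedL2.entry, ← MemLp.toLp_sub, inner_toLp]
  exact integral_congr_ae (Filter.Eventually.of_forall fun ω => pow_two _)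

/-! ### Gaussian processes -/

theorem gaussPath_entry (a : Path T d) (L : BlockLower T d) (ω : Ω) (i : Fin T × Fin d) :
    gaussPath B a L ω i.1 i.2
      = a i.1 i.2 + ∑ j : Fin T × Fin d, row L j.1 i j.2 * B.G j.1 ω j.2 := by
  rw [Fintype.sum_prod_type]
  simp only [gaussPath, PiLp.add_apply, WithLp.ofLp_sum, Finset.sum_apply,
    Matrix.ofLp_toEuclideanCLM]
  rfl

theorem memLp_sum_coord (L : BlockLower T d) (i : Fin T × Fin d) :
    MemLp (fun ω => ∑ j : Fin T × Fin d, row L j.1 i j.2 * B.G j.1 ω j.2) 2 μ :=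
  memLp_finsetSum _ fun j _ => (B.memLp_coord j).const_mul _

theorem integral_gaussProc_entry (a : Path T d) (L : BlockLower T d) (i : Fin T × Fin d) :
    ∫ ω, (gaussProc B a L).path ω i.1 i.2 ∂μ = a i.1 i.2 := by
  simp only [gaussProc, gaussPath_entry]
  rw [integral_add (integrable_const _) ((memLp_sum_coord L i).integrable one_le_two),
    integral_finsetSum _ fun j _ => ((B.memLp_coord j).integrable one_le_two).const_mul _]
  simp [integral_const_mul, B.integral_coord]

theorem incr_gaussProc_entry (a : Path T d) (L : BlockLower T d) (k : Fin T)
    (i : Fin T × Fin d) : B.incr k ((gaussProc B a L).entry i)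
      = ∑ j : Fin T × Fin d, (if j.1 = k then row L j.1 i j.2 else 0) • B.coord j := by
  have hc : MemLp (fun _ : Ω => a i.1 i.2) 2 μ := memLp_const _
  have h : (gaussProc B a L).entry i
      = hc.toLp _ + ∑ j : Fin T × Fin d, row L j.1 i j.2 • B.coord j := by
    rw [AdaptedL2.entry]
    simp only [GaussianBasis.coord]
    rw [← toLp_sum _ _ _ (memLp_sum_coord L i), ← MemLp.toLp_add]
    exact MemLp.toLp_congr _ _ (Filter.Eventually.of_forall fun ω => gaussPath_entry a L ω i)
  have hconst : B.incr k.1 (hc.toLp _) = 0 := by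
    have hm : ∀ n, B.proj n (hc.toLp _) = hc.toLp _ := fun n =>
      B.proj_toLp_of_measurable n hc (@measurable_const _ _ _ (B.hist n) _)
    rw [GaussianBasis.incr, sub_apply, hm, hm, sub_self]
  rw [h, map_add, hconst, zero_add, map_sum]
  refine Finset.sum_congr rfl fun j _ => ?_
  rw [map_smul, B.incr_coord]
  by_cases hj : j.1 = k
  · simp [hj]
  · simp [hj, Fin.val_ne_of_ne hj]

/-- The increment at time `k` retains only the `G k` term, whose coordinates are orthonormal, so
block column `k` is read off isometrically and the means drop out. -/
theorem inner_incr_gaussProc_entry (a b : Path T d) (L M : BlockLower T d) (k : Fin T)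
    (i j : Fin T × Fin d) :
    ⟪B.incr k ((gaussProc B a L).entry i), B.incr k ((gaussProc B b M).entry j)⟫_ℝ
      = ⟪row L k i, row M k j⟫_ℝ := by
  rw [incr_gaussProc_entry, incr_gaussProc_entry, B.orthonormal_coord.inner_sum,
    Fintype.sum_prod_type, Finset.sum_eq_single k (fun s _ hs => by simp [hs]) (by simp)]
  simp [PiLp.inner_apply, mul_comm]

theorem AdEquiv.inner_incr_eq_row {X' : AdaptedL2 B} {a : Path T d} {L : BlockLower T d}
    (h : AdEquiv X' (gaussProc B a L)) (k : Fin T) (i j : Fin T × Fin d) :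
    ⟪B.incr k (X'.entry i), B.incr k (X'.entry j)⟫_ℝ = ⟪row L k i, row L k j⟫_ℝ := by
  rw [h.inner_incr_eq, inner_incr_gaussProc_entry]

/-- The cost of a coupling of two Gaussian processes in terms of their martingale increments. -/
theorem cost_eq_of_adEquiv {X' Y' : AdaptedL2 B} {a b : Path T d} {L M : BlockLower T d}
    (hX : AdEquiv X' (gaussProc B a L)) (hY : AdEquiv Y' (gaussProc B b M)) :
    cost X' Y' = ∑ t, ‖a t - b t‖ ^ 2
      + ∑ k : Fin T, ∑ i, (‖row L k i‖ ^ 2 + ‖row M k i‖ ^ 2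
        - 2 * ⟪B.incr k (X'.entry i), B.incr k (Y'.entry i)⟫_ℝ) := by
  have hab : ∑ t, ‖a t - b t‖ ^ 2 = ∑ i : Fin T × Fin d, (a i.1 i.2 - b i.1 i.2) ^ 2 := by
    simp only [EuclideanSpace.real_norm_sq_eq, Fintype.sum_prod_type, PiLp.sub_apply]
  rw [cost_eq_sum_inner, hab, Finset.sum_comm, ← Finset.sum_add_distrib]
  refine Finset.sum_congr rfl fun i _ => ?_
  simp only [AdaptedL2.inner_entry, hX.integral_entry_eq, hY.integral_entry_eq,
    integral_gaussProc_entry, hX.inner_incr_eq_row, hY.inner_incr_eq_row]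
  simp only [real_inner_self_eq_norm_sq, Finset.sum_add_distrib, Finset.sum_sub_distrib, ← Finset.mul_sum]
  ring

theorem cost_gaussProc (a b : Path T d) (L M : BlockLower T d) :
    cost (gaussProc B a L) (gaussProc B b M) = ∑ t, ‖a t - b t‖ ^ 2 + frobSq (L - M) := by
  rw [cost_eq_of_adEquiv (sameNestedLaw_refl B _ _) (sameNestedLaw_refl B _ _),
    frobSq_eq_sum_row]
  congr 1
  refine Finset.sum_congr rfl fun k _ => Finset.sum_congr rfl fun i _ => ?_
  rw [inner_incr_gaussProc_entry, row_sub, norm_sub_sq_real]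
  ring

/-- Gelbrich's bound is applied separately to the increments at each time; the rotations obtained,
one per time, assemble into a single block-diagonal orthogonal matrix. -/
theorem exists_le_cost {X' Y' : AdaptedL2 B} {a b : Path T d} {L M : BlockLower T d}
    (hX : AdEquiv X' (gaussProc B a L)) (hY : AdEquiv Y' (gaussProc B b M)) :
    ∃ O ∈ BlockOrth T d, ∑ t, ‖a t - b t‖ ^ 2 + frobSq (L - M * O) ≤ cost X' Y' := by
  choose O hO using fun k : Fin T => exists_isometry_sum_inner_le (row L k) (row M k)
    (fun i => B.incr k (X'.entry i)) (fun i => B.incr k (Y'.entry i))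
    (fun i j => hX.inner_incr_eq_row k i j) (fun i j => hY.inner_incr_eq_row k i j)
  obtain ⟨P, hP, hPO⟩ := exists_mem_blockOrth_row_mul O
  refine ⟨P, hP, ?_⟩
  rw [cost_eq_of_adEquiv hX hY, frobSq_eq_sum_row]
  refine add_le_add le_rfl (Finset.sum_le_sum fun k _ => ?_)
  simp only [row_sub, hPO, norm_sub_sq_real, LinearIsometryEquiv.norm_map,
    Finset.sum_add_distrib, Finset.sum_sub_distrib, ← Finset.mul_sum]
  linarith [hO k]

/-- Moving `P` onto the noise exhibits both processes as the same functional `Φ`, evaluated at the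
rotated and at the original basis. -/
theorem adEquiv_gaussProc_mul (a : Path T d) (L : BlockLower T d) {P : BlockLower T d}
    (hP : P ∈ BlockOrth T d) : AdEquiv (gaussProc B a (L * P)) (gaussProc B a L) := by
  obtain ⟨O, hO⟩ := exists_isometry_toEuclideanCLM_mul hP
  let Φ : Path T d → Path T d := fun x t =>
    a t + ∑ s, Matrix.toEuclideanCLM (𝕜 := ℝ) ((L : BlockMatrix T d) t s) (x s)
  have hΦ : Measurable Φ := by
    refine measurable_pi_lambda _ fun t => Measurable.const_add
      (Finset.measurable_fun_sum _ fun s _ => ?_) _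
    exact (ContinuousLinearMap.continuous _).measurable.comp (measurable_pi_apply s)
  refine sameNestedLaw_symm B _ (sameNestedLaw_of_hist_eq (B.hist_rotate O) _ hΦ
    (Filter.Eventually.of_forall fun ω => rfl) (Filter.Eventually.of_forall fun ω => ?_))
  funext t
  simp only [gaussProc, gaussPath, hO]
  rfl

theorem gaussianClass_mul (L : BlockLower T d) {P : BlockLower T d} (hP : P ∈ BlockOrth T d) :
    gaussianClass B (L * P) = gaussianClass B L :=
  Quotient.sound (adEquiv_gaussProc_mul 0 L hP)

theorem awSq_gaussProc (a b : Path T d) (L M : BlockLower T d) :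
    awSq (gaussProc B a L) (gaussProc B b M) = ∑ t, ‖a t - b t‖ ^ 2 + orbitDist L M ^ 2 := by
  obtain ⟨P, hP, h⟩ := exists_orbitDist_eq L M
  refine IsLeast.csInf_eq ⟨⟨gaussProc B a L, gaussProc B b (M * P), sameNestedLaw_refl B _ _,
    adEquiv_gaussProc_mul b M hP, ?_⟩, ?_⟩
  · rw [cost_gaussProc, h, norm_entries_sq]
  · rintro c ⟨X', Y', hX, hY, rfl⟩
    obtain ⟨O, hO, hle⟩ := exists_le_cost hX hY
    refine le_trans ?_ hle
    rw [← norm_entries_sq]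
    gcongr
    · exact orbitDist_nonneg _ _
    · exact orbitDist_le hO

theorem AW_gaussProc_sq (a b : Path T d) (L M : BlockLower T d) :
    AW (⟦gaussProc B a L⟧ : FP B) ⟦gaussProc B b M⟧ ^ 2
      = ∑ t, ‖a t - b t‖ ^ 2 + orbitDist L M ^ 2 := by
  rw [← awSq_gaussProc (B := B)]
  refine Real.sq_sqrt ?_
  rw [Quotient.lift₂_mk, awSq_gaussProc]
  positivity

theorem AW_gaussianClass (L M : BlockLower T d) :
    AW (gaussianClass B L) (gaussianClass B M) = orbitDist L M := by
  have h : 0 ≤ AW (gaussianClass B L) (gaussianClass B M) := Real.sqrt_nonneg _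
  refine (sq_eq_sq₀ h (orbitDist_nonneg _ _)).1 ?_
  rw [gaussianClass, gaussianClass, AW_gaussProc_sq]
  simp

end Adapted

/-! ### Geodesics in the quotient and their lifts -/

section Geodesics

variable {T d : ℕ}

/-- Along a curve of constant speed in the quotient, finitely many points can be represented by
matrices whose mutual distances equal the quotient distances. -/
theorem exists_aligned_representatives {F : unitInterval → BlockLower T d} {D : ℝ}
    (hF : ∀ u v : unitInterval, orbitDist (F u) (F v) = |(u : ℝ) - v| * D)
    (S : Finset unitInterval) :
    ∃ g : unitInterval → BlockLower T d, (∀ u, ∃ O ∈ BlockOrth T d, g u = F u * O) ∧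
      ∀ u ∈ S, ∀ v ∈ S, ‖entries (g u - g v)‖ = |(u : ℝ) - v| * D := by
  classical
  induction S using Finset.induction_on_max with
  | empty => exact ⟨F, fun u => ⟨1, one_mem_blockOrth, (mul_one _).symm⟩, by simp⟩
  | insert w S hw ih =>
    obtain ⟨g, hg, hgS⟩ := ih
    rcases S.eq_empty_or_nonempty with rfl | hS
    · refine ⟨g, hg, ?_⟩
      simp
    · have hmS := S.max'_mem hS
      set m := S.max' hS with hm
      -- The new latest time `w` is aligned only with its predecessor `m`. Distances to earlier
      -- times then follow from the triangle inequality through `m`, since constant speed makes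
      -- lengths additive.
      obtain ⟨P, hP, hmw⟩ := exists_orbitDist_eq (g m) (F w)
      obtain ⟨O, hO, hgm⟩ := hg m
      rw [hgm, orbitDist_mul_left hO, ← hgm, hF] at hmw
      let g' := Function.update g w (F w * P)
      have hg' : ∀ u, ∃ O ∈ BlockOrth T d, g' u = F u * O := fun u => by
        by_cases h : u = w
        · subst h
          exact ⟨P, hP, Function.update_self ..⟩
        · simpa [g', Function.update_of_ne h] using hg u
      have hg'S : ∀ u ∈ S, g' u = g u := fun u hu => Function.update_of_ne (hw u hu).ne _ _
      have hg'w : g' w = F w * P := Function.update_self ..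
      have key : ∀ u ∈ S, ‖entries (g' u - g' w)‖ = |(u : ℝ) - w| * D := by
        intro u hu
        refine le_antisymm ?_ ?_
        · have hum : (u : ℝ) ≤ m := S.le_max' u hu
          have hmw' : (m : ℝ) < w := hw m hmS
          have h1 := hgS u hu m hmS
          rw [hg'S u hu, hg'w]
          calc ‖entries (g u - F w * P)‖
              ≤ ‖entries (g u - g m)‖ + ‖entries (g m - F w * P)‖ := by
                simp only [map_sub]
                exact norm_sub_le_norm_sub_add_norm_sub _ _ _
            _ = |(u : ℝ) - w| * D := by
                rw [h1, ← hmw, abs_of_nonpos (by linarith), abs_of_nonpos (by linarith),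
                  abs_of_nonpos (by linarith)]
                ring
        -- The quotient distance never exceeds the distance of representatives.
        · rw [← hF]
          obtain ⟨O₁, hO₁, e₁⟩ := hg' u
          obtain ⟨O₂, hO₂, e₂⟩ := hg' w
          rw [e₁, e₂, ← orbitDist_mul_left hO₁, ← orbitDist_mul_right hO₂]
          exact orbitDist_le_norm_sub _ _
      refine ⟨g', hg', fun u hu v hv => ?_⟩
      rcases Finset.mem_insert.1 hu with rfl | hu' <;> rcases Finset.mem_insert.1 hv with rfl | hv'
      · simp
      · rw [norm_entries_sub_comm, key v hv', abs_sub_comm]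
      · exact key u hu'
      · rw [hg'S u hu', hg'S v hv', hgS u hu' v hv']

/-- A curve of constant speed in the quotient is the projection of a segment. -/
theorem exists_segment_lift {F : unitInterval → BlockLower T d} {L M : BlockLower T d}
    (h0 : F 0 = L) (h1 : F 1 = M)
    (hF : ∀ u v : unitInterval, orbitDist (F u) (F v) = |(u : ℝ) - v| * orbitDist L M) :
    ∃ P ∈ OptOrth L M, ∀ u : unitInterval,
      ∃ O ∈ BlockOrth T d, (1 - (u : ℝ)) • L + (u : ℝ) • (M * P) = F u * O := by
  classical
  -- Those `P` whose segment passes through the orbit of `F u` at time `u`: a closed set, because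
  -- orbits are compact.
  let K : unitInterval → Set (BlockLower T d) := fun u =>
    (fun P => (1 - (u : ℝ)) • L + (u : ℝ) • (M * P)) ⁻¹' ((fun O => F u * O) '' BlockOrth T d)
  have hcont : ∀ A : BlockLower T d, Continuous fun P : BlockLower T d => A * P := fun A =>
    Continuous.subtype_mk (continuous_const.mul continuous_subtype_val) _
  have hK : ∀ u, IsClosed (K u) := fun u => by
    have hc : Continuous fun P : BlockLower T d => (1 - (u : ℝ)) • L + (u : ℝ) • (M * P) :=
      continuous_const.add ((hcont M).const_smul (u : ℝ))
    exact (isCompact_blockOrth.image (hcont (F u))).isClosed.preimage hc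
  obtain ⟨P, hP, hPK⟩ := (isCompact_optOrth L M).inter_iInter_nonempty K hK fun S => by
    -- The endpoints join the finite set of times so that the aligned points have known ends. The
    -- common rotation `R` below then moves the initial one to `L` itself.
    obtain ⟨g, hg, hgS⟩ := exists_aligned_representatives hF (insert 0 (insert 1 S))
    obtain ⟨O₀, hO₀, e₀⟩ := hg 0
    obtain ⟨O₁, hO₁, e₁⟩ := hg 1
    obtain ⟨R, hR, hOR⟩ := exists_mul_eq_one_of_mem_blockOrth hO₀
    have e₀' : g 0 * R = L := by rw [e₀, h0, mul_assoc, hOR, mul_one]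
    have e₁' : g 1 * R = M * (O₁ * R) := by rw [e₁, h1, mul_assoc]
    have hd : ∀ u ∈ insert 0 (insert 1 S), ∀ v ∈ insert 0 (insert 1 S),
        dist (entries (g u * R)) (entries (g v * R)) = |(u : ℝ) - v| * orbitDist L M := by
      intro u hu v hv
      rw [dist_eq_norm, ← map_sub, ← sub_mul, norm_entries_mul hR, hgS u hu v hv]
    have hLM : dist (entries L) (entries (M * (O₁ * R))) = orbitDist L M := by
      rw [← e₀', ← e₁', hd 0 (by simp) 1 (by simp)]
      simp [e₀']
    refine ⟨O₁ * R, mem_optOrth_iff.2 ⟨mul_mem_blockOrth hO₁ hR, ?_⟩, ?_⟩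
    · rw [map_sub, ← dist_eq_norm, hLM]
    · refine Set.mem_iInter₂.2 fun u hu => ?_
      have huS : u ∈ insert (0 : unitInterval) (insert 1 S) := by simp [hu]
      have hu0 := u.2.1
      have hu1 := u.2.2
      -- Strict convexity of the Euclidean norm: equality in the triangle inequality, with these
      -- proportions, places the point on the segment.
      have hline := eq_lineMap_of_dist_eq_mul_of_dist_eq_mul
        (x := entries L) (y := entries (g u * R)) (z := entries (M * (O₁ * R))) (r := (u : ℝ))
        (by rw [hLM, ← e₀', hd 0 (by simp) u huS, e₀']; simp [abs_of_nonneg hu0])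
        (by rw [hLM, ← e₁', hd u huS 1 (by simp), abs_of_nonpos (by simpa using hu1)]; simp)
      obtain ⟨O, hO, e⟩ := hg u
      refine ⟨O * R, mul_mem_blockOrth hO hR, ?_⟩
      change F u * (O * R) = _
      rw [← mul_assoc, ← e]
      refine entries_injective ?_
      rw [hline, AffineMap.lineMap_apply_module, map_add, map_smul, map_smul]
  refine ⟨P, hP, fun u => ?_⟩
  obtain ⟨O, hO, h⟩ := Set.mem_iInter.1 hPK u
  exact ⟨O, hO, h.symm⟩

/-- Segments between optimally aligned matrices have constant speed in the quotient. -/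
theorem orbitDist_segment {L M P : BlockLower T d} (hP : P ∈ OptOrth L M) (u v : unitInterval) :
    orbitDist ((1 - (u : ℝ)) • L + (u : ℝ) • (M * P)) ((1 - (v : ℝ)) • L + (v : ℝ) • (M * P))
      = |(u : ℝ) - v| * orbitDist L M := by
  obtain ⟨hPO, hD⟩ := mem_optOrth_iff.1 hP
  have hle : ∀ s t : ℝ, orbitDist ((1 - s) • L + s • (M * P)) ((1 - t) • L + t • (M * P))
      ≤ |s - t| * orbitDist L M := by
    intro s t
    refine (orbitDist_le_norm_sub _ _).trans (le_of_eq ?_)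
    have h : (1 - s) • L + s • (M * P) - ((1 - t) • L + t • (M * P)) = (t - s) • (L - M * P) := by
      module
    rw [h, map_smul, norm_smul, hD, Real.norm_eq_abs, abs_sub_comm]
  -- The upper bounds on `[0, s]` and `[t, 1]` leave at least `(t - s)` times the total distance for
  -- the middle piece.
  have key : ∀ s t : ℝ, 0 ≤ s → s ≤ t → t ≤ 1 → |s - t| * orbitDist L M
      ≤ orbitDist ((1 - s) • L + s • (M * P)) ((1 - t) • L + t • (M * P)) := by
    intro s t hs hst ht
    have h0 := hle 0 s
    have h1 := hle t 1
    have h2 := orbitDist_triangle ((1 - (0 : ℝ)) • L + (0 : ℝ) • (M * P))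
      ((1 - s) • L + s • (M * P)) ((1 - (1 : ℝ)) • L + (1 : ℝ) • (M * P))
    have h3 := orbitDist_triangle ((1 - s) • L + s • (M * P)) ((1 - t) • L + t • (M * P))
      ((1 - (1 : ℝ)) • L + (1 : ℝ) • (M * P))
    have h4 : orbitDist ((1 - (0 : ℝ)) • L + (0 : ℝ) • (M * P))
        ((1 - (1 : ℝ)) • L + (1 : ℝ) • (M * P)) = orbitDist L M := by
      simp [orbitDist_mul_right hPO]
    rw [abs_of_nonpos (by linarith)] at h0 h1 ⊢
    linarith
  refine le_antisymm (hle u v) ?_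
  rcases le_total (u : ℝ) v with h | h
  · exact key u v u.2.1 h v.2.2
  · rw [abs_sub_comm, orbitDist_comm (_ + _)]
    exact key v u v.2.1 h u.2.2

variable {Ω : Type*} [mΩ : MeasurableSpace Ω] [StandardBorelSpace Ω]
  {μ : Measure Ω} [IsProbabilityMeasure μ] {B : GaussianBasis μ T d}

/-- A Gaussian process on a geodesic between centered Gaussian processes is centered. -/
theorem eq_gaussianClass_of_between {L M N : BlockLower T d} {a : Path T d} {u : ℝ}
    (hu0 : 0 ≤ u) (hu1 : u ≤ 1)
    (h0 : AW (gaussianClass B L) ⟦gaussProc B a N⟧ = u * orbitDist L M)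
    (h1 : AW ⟦gaussProc B a N⟧ (gaussianClass B M) = (1 - u) * orbitDist L M) : a = 0 := by
  have e0 := AW_gaussProc_sq (B := B) 0 a L N
  have e1 := AW_gaussProc_sq (B := B) a 0 N M
  change AW (gaussianClass B L) _ ^ 2 = _ at e0
  change AW _ (gaussianClass B M) ^ 2 = _ at e1
  have hD := orbitDist_nonneg L M
  have ha : 0 ≤ ∑ t, ‖a t‖ ^ 2 := by positivity
  simp only [Pi.zero_apply, zero_sub, sub_zero, norm_neg] at e0 e1
  rw [h0] at e0
  rw [h1] at e1
  -- Dropping the mean gives upper bounds on the two matrix distances. The triangle inequality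
  -- forces equality in them, so no contribution of the mean remains.
  have f0 : orbitDist L N ≤ u * orbitDist L M :=
    abs_le_of_sq_le_sq' (by linarith) (by positivity) |>.2
  have f1 : orbitDist N M ≤ (1 - u) * orbitDist L M :=
    abs_le_of_sq_le_sq' (by linarith) (mul_nonneg (by linarith) hD) |>.2
  have f2 := orbitDist_triangle L N M
  have f3 : orbitDist L N = u * orbitDist L M := by linarith
  rw [f3] at e0
  have hsum : ∑ t, ‖a t‖ ^ 2 = 0 := by linarith
  rw [Finset.sum_eq_zero_iff_of_nonneg fun t _ => by positivity] at hsum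
  funext t
  simpa using hsum t (Finset.mem_univ t)

end Geodesics

end AdaptedBW

end

/-! ### The three claims, deduced from the quotient geometry -/

theorem theorem2p4 {Ω : Type*} [MeasurableSpace Ω] [StandardBorelSpace Ω]
    (μ : MeasureTheory.Measure Ω) [MeasureTheory.IsProbabilityMeasure μ] (T d : ℕ)
    (B : AdaptedBW.GaussianBasis μ T d) (L M : AdaptedBW.BlockLower T d)
    (x y : AdaptedBW.FP B)
    (hx : x = AdaptedBW.gaussianClass B L) (hy : y = AdaptedBW.gaussianClass B M) :
    (∀ P ∈ AdaptedBW.OptOrth L M,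
      AdaptedBW.IsOptimalRep x y
        (AdaptedBW.gaussProc B 0 L) (AdaptedBW.gaussProc B 0 (M * P))) ∧
    (∀ P ∈ AdaptedBW.OptOrth L M,
      AdaptedBW.IsGeodesicGP (AdaptedBW.interpolation B L M P) ∧
        AdaptedBW.interpolation B L M P 0 = x ∧ AdaptedBW.interpolation B L M P 1 = y) ∧
    (∀ γ : unitInterval → AdaptedBW.FP B,
      AdaptedBW.IsGeodesicGP γ → γ 0 = x → γ 1 = y →
        ∃ P ∈ AdaptedBW.OptOrth L M, ∀ u, γ u = AdaptedBW.interpolation B L M P u) := by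
  open AdaptedBW in
  subst hx hy
  refine ⟨fun P hP => ?_, fun P hP => ?_, fun γ hγ h0 h1 => ?_⟩
  · obtain ⟨hPO, hD⟩ := mem_optOrth_iff.1 hP
    refine ⟨rfl, gaussianClass_mul M hPO, ?_⟩
    rw [AW_gaussianClass, cost_gaussProc, ← hD, norm_entries_sq]
    simp
  · obtain ⟨hPO, hD⟩ := mem_optOrth_iff.1 hP
    have i0 : interpolation B L M P 0 = gaussianClass B L := by simp [interpolation]
    have i1 : interpolation B L M P 1 = gaussianClass B M := by
      simp [interpolation, gaussianClass_mul M hPO]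
    refine ⟨⟨fun u => ⟨0, _, rfl⟩, fun u v => ?_⟩, i0, i1⟩
    rw [i0, i1, interpolation, interpolation, AW_gaussianClass, AW_gaussianClass,
      orbitDist_segment hP]
  · obtain ⟨hGP, hspeed⟩ := hγ
    choose a N hN using hGP
    have hspeed' : ∀ u v : unitInterval,
        AW (γ u) (γ v) = |(u : ℝ) - v| * orbitDist L M := fun u v => by
      rw [hspeed, h0, h1, AW_gaussianClass]
    have hγN : ∀ u, γ u = gaussianClass B (N u) := fun u => by
      have e0 := hspeed' 0 u
      have e1 := hspeed' u 1
      rw [h0, hN u, abs_sub_comm] at e0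
      rw [h1, hN u, abs_sub_comm] at e1
      have ha : a u = 0 := eq_gaussianClass_of_between u.2.1 u.2.2
        (by simpa [abs_of_nonneg u.2.1] using e0)
        (by simpa [abs_of_nonneg (sub_nonneg.2 u.2.2)] using e1)
      rw [hN u, ha]
      rfl
    classical
    -- The chosen matrices `N 0` and `N 1` need only represent the classes of `L` and `M`; the
    -- values at the endpoints are reset so that the lifted segment starts at `L` and ends in the
    -- orbit of `M`.
    let F : unitInterval → BlockLower T d := fun u => if u = 0 then L else if u = 1 then M else N u
    have hγF : ∀ u, γ u = gaussianClass B (F u) := fun u => by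
      by_cases hu0 : u = 0
      · simp [F, hu0, h0]
      by_cases hu1 : u = 1
      · simp [F, hu1, h1]
      · simp [F, hu0, hu1, hγN]
    obtain ⟨P, hP, hPu⟩ := exists_segment_lift (F := F) (L := L) (M := M) (by simp [F])
      (by simp [F]) fun u v => by
        rw [← hspeed' u v, hγF u, hγF v, AW_gaussianClass]
    refine ⟨P, hP, fun u => ?_⟩
    obtain ⟨O, hO, h⟩ := hPu u
    rw [interpolation, h, gaussianClass_mul _ hO, hγF]
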